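/- Let $q$ be a prime power and $\mathbb{F}_q$ the field with $q$ elements. For $A\subset\mathbb{F}_q$ let $T(A)$ be the number of $(a_1,a_2,a_3,b_1,b_2,b_3)\in A^6$ with $(a_2-a_1)(b_3-b_1)=(a_3-a_1)(b_2-b_1)$ (the number of collinear triples of $A\times A$). For a finite set of points $P\subset\mathbb{F}_q^2$ and a set $L$ of lines in $\mathbb{F}_q^2$ let $I(P,L)=|\{(p,l)\in P\times L: p\in l\}|$, and let $L(P)$ be the number of distinct lines determined by pairs of distinct points of $P$. For every constant $C>0$ there is a constant $K>0$, depending only on $C$, such that the following holds for every prime power $q$. Let $A\subset\mathbb{F}_q$ have at least two elements and suppose that $$|A\cap(cG+d)|\le C\max\{|G|^{1/2},|A|^{51/52}\}$$ for all proper subfields $G$ of $\mathbb{F}_q$ and all $c,d\in\mathbb{F}_q$. Then $$T(A)\le K\left(|A|^{5-1/104}+q^{-1/95}|A|^{5+1/95}\right),$$ for every set $L$ of lines in $\mathbb{F}_q^2$, $$I(A\times A,L)\le K\left(\left(|A|^{173/104}+q^{-1/285}|A|^{476/285}\right)|L|^{2/3}+|L|\right),$$ and $$\min\{|A|^{2+1/52},\,q^{2/95}|A|^{2-2/95}\}\le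 K\,L(A\times A).$$ -/

import Mathlib

/-- `T(A, B)`: the number of `(a₁, a₂, a₃, b₁, b₂, b₃) ∈ A³ × B³` with
`(a₂ - a₁)(b₃ - b₁) = (a₃ - a₁)(b₂ - b₁)`, i.e. the number of collinear triples of `A × B`. -/
noncomputable def collinearTriples {F : Type*} [Field F] (A B : Finset F) : ℕ :=
  Set.ncard {t : (F × F × F) × (F × F × F) |
    (t.1.1 ∈ A ∧ t.1.2.1 ∈ A ∧ t.1.2.2 ∈ A) ∧
    (t.2.1 ∈ B ∧ t.2.2.1 ∈ B ∧ t.2.2.2 ∈ B) ∧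
    (t.1.2.1 - t.1.1) * (t.2.2.2 - t.2.1) = (t.1.2.2 - t.1.1) * (t.2.2.1 - t.2.1)}

/-- A line in the affine plane `F²`: an affine subspace of dimension one. -/
def IsPlaneLine {F : Type*} [Field F] (l : AffineSubspace F (F × F)) : Prop :=
  Module.finrank F l.direction = 1

/-- `I(P, L)`: the number of pairs `(p, l) ∈ P × L` with `p ∈ l`. -/
noncomputable def incidences {F : Type*} [Field F] (P : Finset (F × F))
    (L : Finset (AffineSubspace F (F × F))) : ℕ :=
  Set.ncard {x : (F × F) × AffineSubspace F (F × F) | x.1 ∈ P ∧ x.2 ∈ L ∧ x.1 ∈ x.2}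

/-- `L(P)`: the number of distinct lines determined by pairs of distinct points of `P`. -/
noncomputable def determinedLines {F : Type*} [Field F] (P : Finset (F × F)) : ℕ :=
  Set.ncard {l : AffineSubspace F (F × F) |
    ∃ p ∈ P, ∃ r ∈ P, p ≠ r ∧ l = affineSpan F {p, r}}

/-- The affine image `c G + d = {c g + d : g ∈ G}` of a subfield `G`. -/
def subfieldAffineImage {F : Type*} [Field F] (G : Subfield F) (c d : F) : Set F :=
  {x : F | ∃ g ∈ G, x = c * g + d}

/-- The non-concentration condition `|A ∩ (cG + d)| ≤ C max {|G|^{1/2}, |A|^{51/52}}` for all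
proper subfields `G` and all elements `c, d`. -/
def AvoidsSubfields {F : Type*} [Field F] (C : ℝ) (A : Finset F) : Prop :=
  ∀ G : Subfield F, G ≠ ⊤ → ∀ c d : F,
    (Set.ncard ((A : Set F) ∩ subfieldAffineImage G c d) : ℝ) ≤
      C * max ((Nat.card G : ℝ) ^ (1 / 2 : ℝ)) ((A.card : ℝ) ^ (51 / 52 : ℝ))

/-! Up to $O(|A|^4)$ degenerate cases, a collinear triple of $A\times A$ is a pair of triples of
distinct elements of $A$ with the same ratio $r=(a_2-a_1)/(a_3-a_1)$, that is, $a_2=(1-r)a_1+ra_3$.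
Let there be $\tau|A|^5$ such pairs; everything rests on an upper bound for $\tau$.

Three selections extract structure. A Balog–Szemerédi–Gowers argument gives $X\subset A$ with
$|X|\gg\tau|A|$ and $|X-X|\ll\tau^{-5}|A|$. Pigeonholing gives $Y\subset A$ inside an affine image
of $X$. Cauchy–Schwarz and further pigeonholing give $S\subset X$ such that each multiplier
$l(x-b)$, $x\in S$, sends many points of $X$ into a translate of $X$
(`exists_subset_nearlyPreserves`).

The pivot argument (`pivot_bound`) then studies the set $R$ of quotients of differences of
$T=\{0,1\}\cup l(S-b)$. If $R$ is not closed under $r\mapsto 1+r$ or under multiplication by $T$,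
some $r\notin R$ has one of these two forms, and $(x,y)\mapsto x+ry$ is injective on $S\times S$. If
$R$ is closed, it is a subfield $G\supset l(S-b)$, and some $r\in G$ has few collisions by
averaging. In each case, clearing denominators writes the map through six applications of
multipliers that nearly preserve $X$, so a restriction of $S\times S$ that keeps much of its spread
is mapped into a translate of $3X-3X$. That set is small by Plünnecke–Ruzsa. Comparing sizes gives
$|A|\tau^{93}\ll 1+|S|^2/|G|$ with $|S|\gg\tau^2|A|$.

If $G$ is the whole field, $|S|^2/|G|\le|A|^2/q$. If $G$ is proper, non-concentration gives either
$|S|^2\ll|G|$ or $\tau^2\ll|A|^{-1/52}$. This bounds $T(A)$. Since $T(A)$ controls the third moment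
of the number of points on a line, Hölder's inequality gives the incidence bound and the bound on
determined lines. -/

section

open Finset Pointwise

/-- The number of ordered pairs in `P` on which `φ` takes the same value. -/
def collisions {ι β : Type*} [DecidableEq β] (P : Finset ι) (φ : ι → β) : ℕ :=
  #{p ∈ P ×ˢ P | φ p.1 = φ p.2}

/-! ### Collision counts, and restrictions that keep the spread of a map -/

section Collisions

variable {ι κ β : Type*} [DecidableEq β]

theorem card_filter_eq_sum_fibers (P : Finset ι) (Q : Finset κ) (f : ι → β) (g : κ → β)
    (R : Finset β) (hR : ∀ p ∈ P, f p ∈ R) :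
    #{x ∈ P ×ˢ Q | f x.1 = g x.2} = ∑ r ∈ R, #{p ∈ P | f p = r} * #{q ∈ Q | g q = r} := by
  rw [Finset.card_eq_sum_card_fiberwise (f := fun x : ι × κ => f x.1) (t := R)]
  · refine Finset.sum_congr rfl fun r _ => ?_
    rw [← Finset.card_product]
    congr 1
    ext ⟨p, q⟩
    simp only [mem_filter, mem_product]
    constructor
    · rintro ⟨⟨⟨h1, h2⟩, h3⟩, h4⟩
      exact ⟨⟨h1, h4⟩, h2, h3 ▸ h4⟩
    · rintro ⟨⟨h1, h4⟩, h2, h3⟩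
      exact ⟨⟨⟨h1, h2⟩, h4.trans h3.symm⟩, h4⟩
  · intro x hx
    simp only [coe_filter, mem_product, Set.mem_ofPred_eq] at hx
    exact hR _ hx.1.1

theorem sq_card_matching_le (P : Finset ι) (Q : Finset κ) (f : ι → β) (g : κ → β) :
    (#{x ∈ P ×ˢ Q | f x.1 = g x.2}) ^ 2 ≤ collisions P f * collisions Q g := by
  classical
  have hP : ∀ p ∈ P, f p ∈ P.image f ∪ Q.image g := fun p hp =>
    mem_union_left _ (mem_image_of_mem _ hp)
  have hQ : ∀ p ∈ Q, g p ∈ P.image f ∪ Q.image g := fun p hp =>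
    mem_union_right _ (mem_image_of_mem _ hp)
  unfold collisions
  rw [card_filter_eq_sum_fibers P Q f g _ hP, card_filter_eq_sum_fibers P P f f _ hP,
    card_filter_eq_sum_fibers Q Q g g _ hQ]
  simpa only [sq] using Finset.sum_mul_sq_le_sq_mul_sq (P.image f ∪ Q.image g)
    (fun r => #{p ∈ P | f p = r}) (fun r => #{q ∈ Q | g q = r})

theorem sq_card_le_card_image_mul_collisions (P : Finset ι) (φ : ι → β) :
    #P ^ 2 ≤ #(P.image φ) * collisions P φ := by
  have h := card_filter_eq_sum_fibers P P φ φ (P.image φ) fun p hp => mem_image_of_mem _ hp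
  have h2 := Finset.card_eq_sum_card_image φ P
  unfold collisions
  rw [h, h2]
  have := sq_sum_le_card_mul_sum_sq (s := P.image φ) (f := fun r => #{p ∈ P | φ p = r})
  simpa only [sq, Nat.cast_id] using this

theorem card_le_collisions (P : Finset ι) (φ : ι → β) : #P ≤ collisions P φ := by
  refine Finset.card_le_card_of_injOn (fun p => (p, p)) ?_ ?_
  · intro p hp
    simpa using hp
  · intro p _ q _ h
    exact (Prod.ext_iff.1 h).1

theorem collisions_le_of_injOn (P : Finset ι) (φ : ι → β) (h : Set.InjOn φ P) :
    collisions P φ ≤ #P := by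
  refine Finset.card_le_card_of_injOn Prod.fst ?_ ?_
  · intro p hp
    simp only [coe_filter, mem_product, Set.mem_ofPred_eq] at hp
    exact hp.1.1
  · rintro ⟨p, p'⟩ hp ⟨q, q'⟩ hq hpq
    simp only [coe_filter, mem_product, Set.mem_ofPred_eq] at hp hq hpq
    have h1 := h hp.1.1 hp.1.2 hp.2
    have h2 := h hq.1.1 hq.1.2 hq.2
    rw [← h1, ← h2, hpq]

variable {G : Type*} [AddCommGroup G] [DecidableEq G]

/-- Averaging over the translates $t+W$. Each point of $P$ lies in exactly $|W|$ of the pieces, so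
the pieces have total size $|P||W|$, and their collisions total at most $|W|$ times those of $P$.
Cauchy–Schwarz bounds the sum of squared sizes from below, so some piece has a ratio of collisions
to squared size no worse than the average. This plays the role of a covering lemma. -/
theorem exists_restriction (P : Finset ι) (hP : P.Nonempty) (φ : ι → β) (ψ : ι → G)
    (X W : Finset G) (hψ : ∀ p ∈ P, ψ p ∈ X) (hW : W.Nonempty) :
    ∃ t, {p ∈ P | ψ p - t ∈ W}.Nonempty ∧
      #P ^ 2 * #W * collisions {p ∈ P | ψ p - t ∈ W} φ ≤
        #(X - W) * collisions P φ * #{p ∈ P | ψ p - t ∈ W} ^ 2 := by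
  set Q : G → Finset ι := fun t => {p ∈ P | ψ p - t ∈ W} with hQ
  have hsum : ∑ t ∈ X - W, #(Q t) = #P * #W := by
    have h1 : ∀ p ∈ P, #{t ∈ X - W | ψ p - t ∈ W} = #W := by
      intro p hp
      refine Finset.card_bij' (fun t _ => ψ p - t) (fun w _ => ψ p - w) ?_ ?_ ?_ ?_
      · intro t ht; exact (mem_filter.1 ht).2
      · intro w hw
        rw [mem_filter]
        exact ⟨sub_mem_sub (hψ p hp) hw, by simpa using hw⟩
      · intro t _; simp
      · intro t _; simp
    calc ∑ t ∈ X - W, #(Q t) = ∑ p ∈ P, #{t ∈ X - W | ψ p - t ∈ W} :=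
          Finset.sum_card_bipartiteAbove_eq_sum_card_bipartiteBelow (fun t p => ψ p - t ∈ W)
      _ = #P * #W := by rw [Finset.sum_congr rfl h1]; simp
  have hcoll : ∑ t ∈ X - W, collisions (Q t) φ ≤ #W * collisions P φ := by
    have h1 : ∀ t, collisions (Q t) φ ≤
        #{x ∈ {x ∈ P ×ˢ P | φ x.1 = φ x.2} | ψ x.1 - t ∈ W} := by
      intro t
      refine Finset.card_le_card fun x hx => ?_
      simp only [hQ, mem_filter, mem_product] at hx ⊢
      tauto
    calc ∑ t ∈ X - W, collisions (Q t) φ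
        ≤ ∑ t ∈ X - W, #{x ∈ {x ∈ P ×ˢ P | φ x.1 = φ x.2} | ψ x.1 - t ∈ W} :=
          Finset.sum_le_sum fun t _ => h1 t
      _ = ∑ x ∈ {x ∈ P ×ˢ P | φ x.1 = φ x.2}, #{t ∈ X - W | ψ x.1 - t ∈ W} :=
          Finset.sum_card_bipartiteAbove_eq_sum_card_bipartiteBelow
            (fun t (x : ι × ι) => ψ x.1 - t ∈ W)
      _ ≤ ∑ x ∈ {x ∈ P ×ˢ P | φ x.1 = φ x.2}, #W := by
          refine Finset.sum_le_sum fun x _ => ?_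
          refine Finset.card_le_card_of_injOn (fun t => ψ x.1 - t) ?_ ?_
          · intro t ht; exact (mem_filter.1 ht).2
          · intro a _ b _ h; simpa using h
      _ = #W * collisions P φ := by rw [Finset.sum_const, smul_eq_mul, mul_comm]; rfl
  -- If every nonempty piece failed, summing the failures over $t$ would contradict the two totals
  -- above; strictness comes from a single nonempty piece.
  by_contra! hcon
  have hstep : ∀ t ∈ X - W, #(X - W) * collisions P φ * #(Q t) ^ 2 ≤
      #P ^ 2 * #W * collisions (Q t) φ := by
    intro t _
    rcases (Q t).eq_empty_or_nonempty with h | h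
    · rw [h]; simp
    · exact (hcon t h).le
  have hlt : ∑ t ∈ X - W, #(X - W) * collisions P φ * #(Q t) ^ 2 <
      ∑ t ∈ X - W, #P ^ 2 * #W * collisions (Q t) φ := by
    refine Finset.sum_lt_sum hstep ?_
    have hpos : 0 < ∑ t ∈ X - W, #(Q t) := by
      rw [hsum]; exact Nat.mul_pos hP.card_pos hW.card_pos
    obtain ⟨t, ht, ht'⟩ := Finset.exists_ne_zero_of_sum_ne_zero hpos.ne'
    exact ⟨t, ht, hcon t (card_ne_zero.1 ht')⟩
  rw [← Finset.mul_sum, ← Finset.mul_sum] at hlt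
  have hcs := sq_sum_le_card_mul_sum_sq (s := X - W) (f := fun t => #(Q t))
  rw [hsum, Nat.cast_id] at hcs
  have h1 : collisions P φ * (#P * #W) ^ 2 ≤
      #(X - W) * collisions P φ * ∑ t ∈ X - W, #(Q t) ^ 2 := by
    calc _ ≤ collisions P φ * (#(X - W) * ∑ t ∈ X - W, #(Q t) ^ 2) := by gcongr
      _ = _ := by ring
  have h2 : #P ^ 2 * #W * ∑ t ∈ X - W, collisions (Q t) φ ≤
      #P ^ 2 * #W * (#W * collisions P φ) := by gcongr
  have h3 : #P ^ 2 * #W * (#W * collisions P φ) = collisions P φ * (#P * #W) ^ 2 := by ring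
  omega

/-- The ratio `|P|² / collisions(P, φ)`, a lower bound for `|φ(P)|`. -/
noncomputable def spread (P : Finset ι) (φ : ι → β) : ℝ :=
  (#P : ℝ) ^ 2 / collisions P φ

theorem spread_nonneg (P : Finset ι) (φ : ι → β) : 0 ≤ spread P φ := by
  unfold spread; positivity

theorem spread_le_card_image (P : Finset ι) (φ : ι → β) : spread P φ ≤ #(P.image φ) := by
  unfold spread
  refine div_le_of_le_mul₀ (by positivity) (by positivity) ?_
  exact_mod_cast sq_card_le_card_image_mul_collisions P φ

theorem exists_restriction_spread (P : Finset ι) (hP : P.Nonempty) (φ : ι → β) (ψ : ι → G)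
    (X W : Finset G) (hψ : ∀ p ∈ P, ψ p ∈ X) (hW : W.Nonempty) (hWX : W ⊆ X) :
    ∃ t, {p ∈ P | ψ p - t ∈ W}.Nonempty ∧
      (#W / #(X - X) : ℝ) * spread P φ ≤ spread {p ∈ P | ψ p - t ∈ W} φ := by
  obtain ⟨t, ht, h⟩ := exists_restriction P hP φ ψ X W hψ hW
  refine ⟨t, ht, ?_⟩
  unfold spread
  have h1 : 0 < (collisions P φ : ℝ) := by
    exact_mod_cast hP.card_pos.trans_le (card_le_collisions P φ)
  have h2 : 0 < (collisions {p ∈ P | ψ p - t ∈ W} φ : ℝ) := by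
    exact_mod_cast ht.card_pos.trans_le (card_le_collisions _ φ)
  have hXX : #(X - W) ≤ #(X - X) := card_le_card (sub_subset_sub_left hWX)
  have h3 : 0 < (#(X - X) : ℝ) := by
    have hX : X.Nonempty := hW.mono hWX
    exact_mod_cast (hX.sub hX).card_pos
  rw [div_mul_div_comm, div_le_div_iff₀ (by positivity) h2]
  have h4 : #P ^ 2 * #W * collisions {p ∈ P | ψ p - t ∈ W} φ ≤
        #(X - X) * collisions P φ * #{p ∈ P | ψ p - t ∈ W} ^ 2 := by
    refine h.trans ?_
    gcongr
  have h5 : (#P : ℝ) ^ 2 * #W * collisions {p ∈ P | ψ p - t ∈ W} φ ≤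
        #(X - X) * collisions P φ * (#{p ∈ P | ψ p - t ∈ W} : ℝ) ^ 2 := by exact_mod_cast h4
  linarith

end Collisions

/-! ### Multipliers that nearly preserve a set -/

section Pivot

variable {ι F : Type*} [Field F] [DecidableEq F]

/-- `s` nearly preserves `X`: some translate of `s X` meets `X` in at least `w` points. -/
def NearlyPreserves (X : Finset F) (w : ℝ) (s : F) : Prop :=
  ∃ t, w ≤ #{x ∈ X | s * x + t ∈ X}

/-- The restriction lemma with $W$ the set of points of $X$ sent back into $X$ by $z\mapsto sz+t$.
Iterating it makes several products $s\psi$ lie in translates of $X$ simultaneously, at a cost of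
one factor $w/|X-X|$ each. -/
theorem NearlyPreserves.restrict {X : Finset F} {w : ℝ} {s : F} (hs : NearlyPreserves X w s)
    (hw : 0 < w) (P : Finset ι) (hP : P.Nonempty) (φ ψ : ι → F) (hψ : ∀ p ∈ P, ψ p ∈ X) :
    ∃ Q ⊆ P, Q.Nonempty ∧ (w / #(X - X) : ℝ) * spread P φ ≤ spread Q φ ∧
      ∃ c, ∀ p ∈ Q, s * ψ p + c ∈ X := by
  obtain ⟨t, ht⟩ := hs
  have hW : {x ∈ X | s * x + t ∈ X}.Nonempty := by
    rw [← card_pos]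
    exact_mod_cast hw.trans_le ht
  obtain ⟨u, hu, h⟩ := exists_restriction_spread P hP φ ψ X _ hψ hW (filter_subset _ _)
  refine ⟨_, filter_subset _ _, hu, le_trans ?_ h, t - s * u, fun p hp => ?_⟩
  · have := spread_nonneg P φ
    gcongr
  · have := (mem_filter.1 (mem_filter.1 hp).2).2
    convert this using 1
    ring

theorem spread_le_of_translate_mem (P : Finset ι) (φ : ι → F) (c : F) (Z : Finset F)
    (h : ∀ p ∈ P, φ p + c ∈ Z) : spread P φ ≤ #Z := by
  refine (spread_le_card_image P φ).trans ?_
  exact_mod_cast Finset.card_le_card_of_injOn (fun x => x + c)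
    (by intro x hx; obtain ⟨p, hp, rfl⟩ := mem_image.1 hx; exact h p hp)
    (fun a _ b _ h => by simpa using h)

theorem sub_add_sub_add_sub_mem {X : Finset F} {a b c d e f : F} (ha : a ∈ X) (hb : b ∈ X)
    (hc : c ∈ X) (hd : d ∈ X) (he : e ∈ X) (hf : f ∈ X) :
    a - b + (c - d) + (e - f) ∈ 3 • X - 3 • X := by
  have h : a - b + (c - d) + (e - f) = (a + c + e) - (b + d + f) := by ring
  rw [h]
  have h3 : 3 • X = X + X + X := by rw [succ_nsmul, two_nsmul]
  rw [h3]
  exact sub_mem_sub (add_mem_add (add_mem_add ha hc) he) (add_mem_add (add_mem_add hb hd) hf)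

variable {X S : Finset F} {w : ℝ} {p q u v s : F}

/-- Expanded, the form is $ux_1-vx_1+ux_2-vx_2+px_2-qx_2$. One restriction per term puts each
product in a translate of $X$, hence the whole form in a translate of $3X-3X$. -/
theorem spread_add_bound (hw : 0 < w) (hSX : S ⊆ X) (hS : S.Nonempty)
    (hp : NearlyPreserves X w p) (hq : NearlyPreserves X w q) (hu : NearlyPreserves X w u)
    (hv : NearlyPreserves X w v) :
    (w / #(X - X) : ℝ) ^ 6 *
      spread (S ×ˢ S) (fun x => (u - v) * x.1 + ((u - v) + (p - q)) * x.2) ≤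
      #(3 • X - 3 • X) := by
  set φ : F × F → F := fun x => (u - v) * x.1 + ((u - v) + (p - q)) * x.2 with hφ
  have hfst : ∀ x ∈ S ×ˢ S, x.1 ∈ X := fun x hx => hSX (mem_product.1 hx).1
  have hsnd : ∀ x ∈ S ×ˢ S, x.2 ∈ X := fun x hx => hSX (mem_product.1 hx).2
  obtain ⟨P1, h1, n1, s1, c1, e1⟩ := hu.restrict hw (S ×ˢ S) (hS.product hS) φ Prod.fst hfst
  obtain ⟨P2, h2, n2, s2, c2, e2⟩ := hv.restrict hw P1 n1 φ Prod.fst fun x hx => hfst x (h1 hx)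
  replace h1 := h2.trans h1
  obtain ⟨P3, h3, n3, s3, c3, e3⟩ := hu.restrict hw P2 n2 φ Prod.snd fun x hx => hsnd x (h1 hx)
  replace h1 := h3.trans h1
  obtain ⟨P4, h4, n4, s4, c4, e4⟩ := hv.restrict hw P3 n3 φ Prod.snd fun x hx => hsnd x (h1 hx)
  replace h1 := h4.trans h1
  obtain ⟨P5, h5, n5, s5, c5, e5⟩ := hp.restrict hw P4 n4 φ Prod.snd fun x hx => hsnd x (h1 hx)
  replace h1 := h5.trans h1
  obtain ⟨P6, h6, n6, s6, c6, e6⟩ := hq.restrict hw P5 n5 φ Prod.snd fun x hx => hsnd x (h1 hx)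
  have hθ : 0 ≤ (w / #(X - X) : ℝ) := by positivity
  have hfin : spread P6 φ ≤ #(3 • X - 3 • X) := by
    refine spread_le_of_translate_mem P6 φ (c1 - c2 + (c3 - c4) + (c5 - c6)) _
      fun x hx => ?_
    have x5 := h6 hx
    have x4 := h5 x5
    have x3 := h4 x4
    have x2 := h3 x3
    convert sub_add_sub_add_sub_mem (e1 x (h2 x2)) (e2 x x2) (e3 x x3) (e4 x x4) (e5 x x5) (e6 x hx)
      using 1
    simp only [hφ]
    ring
  calc _ = (w / #(X - X) : ℝ) * ((w / #(X - X) : ℝ) * ((w / #(X - X) : ℝ) *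
        ((w / #(X - X) : ℝ) * ((w / #(X - X) : ℝ) * ((w / #(X - X) : ℝ) *
          spread (S ×ˢ S) φ))))) := by ring
    _ ≤ (w / #(X - X) : ℝ) * ((w / #(X - X) : ℝ) * ((w / #(X - X) : ℝ) *
        ((w / #(X - X) : ℝ) * ((w / #(X - X) : ℝ) * spread P1 φ)))) := by gcongr
    _ ≤ (w / #(X - X) : ℝ) * ((w / #(X - X) : ℝ) * ((w / #(X - X) : ℝ) *
        ((w / #(X - X) : ℝ) * spread P2 φ))) := by gcongr
    _ ≤ (w / #(X - X) : ℝ) * ((w / #(X - X) : ℝ) * ((w / #(X - X) : ℝ) * spread P3 φ)) := by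
        gcongr
    _ ≤ (w / #(X - X) : ℝ) * ((w / #(X - X) : ℝ) * spread P4 φ) := by gcongr
    _ ≤ (w / #(X - X) : ℝ) * spread P5 φ := by gcongr
    _ ≤ spread P6 φ := s6
    _ ≤ _ := hfin

/-- The terms are $ux_1$, $vx_1$, $s(px_2)$ and $s(qx_2)$. The last two need two restrictions each:
once $px_2+c$ lies in $X$, the multiplier $s$ can be applied to it. This again makes six. -/
theorem spread_mul_bound (hw : 0 < w) (hSX : S ⊆ X) (hS : S.Nonempty)
    (hp : NearlyPreserves X w p) (hq : NearlyPreserves X w q) (hu : NearlyPreserves X w u)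
    (hv : NearlyPreserves X w v) (hs : NearlyPreserves X w s) :
    (w / #(X - X) : ℝ) ^ 6 *
      spread (S ×ˢ S) (fun x => (u - v) * x.1 + s * (p - q) * x.2) ≤
      #(3 • X - 3 • X) := by
  set φ : F × F → F := fun x => (u - v) * x.1 + s * (p - q) * x.2 with hφ
  have hfst : ∀ x ∈ S ×ˢ S, x.1 ∈ X := fun x hx => hSX (mem_product.1 hx).1
  have hsnd : ∀ x ∈ S ×ˢ S, x.2 ∈ X := fun x hx => hSX (mem_product.1 hx).2
  obtain ⟨P1, h1, n1, s1, c1, e1⟩ := hu.restrict hw (S ×ˢ S) (hS.product hS) φ Prod.fst hfst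
  obtain ⟨P2, h2, n2, s2, c2, e2⟩ := hv.restrict hw P1 n1 φ Prod.fst fun x hx => hfst x (h1 hx)
  replace h1 := h2.trans h1
  obtain ⟨P3, h3, n3, s3, c3, e3⟩ := hp.restrict hw P2 n2 φ Prod.snd fun x hx => hsnd x (h1 hx)
  replace h1 := h3.trans h1
  obtain ⟨P4, h4, n4, s4, c4, e4⟩ := hq.restrict hw P3 n3 φ Prod.snd fun x hx => hsnd x (h1 hx)
  obtain ⟨P5, h5, n5, s5, c5, e5⟩ := hs.restrict hw P4 n4 φ (fun x => p * x.2 + c3)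
    fun x hx => e3 x (h4 hx)
  obtain ⟨P6, h6, n6, s6, c6, e6⟩ := hs.restrict hw P5 n5 φ (fun x => q * x.2 + c4)
    fun x hx => e4 x (h5 hx)
  have hθ : 0 ≤ (w / #(X - X) : ℝ) := by positivity
  -- Only four terms occur; $x_0-x_0$ pads the sum so that it lies in $3X-3X$, as in the additive
  -- case.
  obtain ⟨x₀, hx₀⟩ := hS
  have hx₀ := hSX hx₀
  have hfin : spread P6 φ ≤ #(3 • X - 3 • X) := by
    refine spread_le_of_translate_mem P6 φ
      (c1 - c2 + (s * c3 + c5 - (s * c4 + c6))) _ fun x hx => ?_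
    have x5 := h6 hx
    have x4 := h5 x5
    have x3 := h4 x4
    have x2 := h3 x3
    convert sub_add_sub_add_sub_mem (e1 x (h2 x2)) (e2 x x2) (e5 x x5) (e6 x hx) hx₀ hx₀
      using 1
    simp only [hφ]
    ring
  calc _ = (w / #(X - X) : ℝ) * ((w / #(X - X) : ℝ) * ((w / #(X - X) : ℝ) *
        ((w / #(X - X) : ℝ) * ((w / #(X - X) : ℝ) * ((w / #(X - X) : ℝ) *
          spread (S ×ˢ S) φ))))) := by ring
    _ ≤ (w / #(X - X) : ℝ) * ((w / #(X - X) : ℝ) * ((w / #(X - X) : ℝ) *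
        ((w / #(X - X) : ℝ) * ((w / #(X - X) : ℝ) * spread P1 φ)))) := by gcongr
    _ ≤ (w / #(X - X) : ℝ) * ((w / #(X - X) : ℝ) * ((w / #(X - X) : ℝ) *
        ((w / #(X - X) : ℝ) * spread P2 φ))) := by gcongr
    _ ≤ (w / #(X - X) : ℝ) * ((w / #(X - X) : ℝ) * ((w / #(X - X) : ℝ) * spread P3 φ)) := by
        gcongr
    _ ≤ (w / #(X - X) : ℝ) * ((w / #(X - X) : ℝ) * spread P4 φ) := by gcongr
    _ ≤ (w / #(X - X) : ℝ) * spread P5 φ := by gcongr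
    _ ≤ spread P6 φ := s6
    _ ≤ _ := hfin

end Pivot

/-! ### When quotients of differences form a subfield -/

section DifferenceRatios

variable {F : Type*} [Field F]

/-- The quotients `(p - q) / (u - v)` of differences of elements of `S`. -/
def differenceRatios (S : Set F) : Set F :=
  {r | ∃ p ∈ S, ∃ q ∈ S, ∃ u ∈ S, ∃ v ∈ S, u ≠ v ∧ r = (p - q) / (u - v)}

variable {S : Set F}

theorem neg_mem_differenceRatios {r : F} (hr : r ∈ differenceRatios S) :
    -r ∈ differenceRatios S := by
  obtain ⟨p, hp, q, hq, u, hu, v, hv, h, rfl⟩ := hr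
  exact ⟨q, hq, p, hp, u, hu, v, hv, h, by rw [← neg_div, neg_sub]⟩

theorem zero_mem_differenceRatios (h0 : 0 ∈ S) (h1 : 1 ∈ S) : 0 ∈ differenceRatios S :=
  ⟨0, h0, 0, h0, 1, h1, 0, h0, one_ne_zero, by simp⟩

/-- An injection of a finite set into itself is a bijection. -/
theorem inv_mul_mem_of_forall_mul_mem [Finite F] {R : Set F} {g : F} (hg : g ≠ 0)
    (h : ∀ r ∈ R, g * r ∈ R) {r : F} (hr : r ∈ R) : g⁻¹ * r ∈ R := by
  have hinj : Set.InjOn (fun x => g * x) R := fun a _ b _ hab => mul_left_cancel₀ hg hab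
  have himg : (fun x => g * x) '' R = R :=
    Set.eq_of_subset_of_ncard_le (Set.image_subset_iff.2 h) hinj.ncard_image.ge
  rw [← himg] at hr
  obtain ⟨x, hx, rfl⟩ := hr
  simpa [inv_mul_cancel_left₀ hg] using hx

/-- If the difference ratios of `S ∋ 0, 1` are closed under `r ↦ r + 1` and under multiplication by
elements of `S`, then they form a subfield. -/
theorem exists_subfield_eq_differenceRatios [Finite F] (h0 : 0 ∈ S) (h1 : 1 ∈ S)
    (hadd : ∀ r ∈ differenceRatios S, 1 + r ∈ differenceRatios S)
    (hmul : ∀ s ∈ S, ∀ r ∈ differenceRatios S, s * r ∈ differenceRatios S) :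
    ∃ G : Subfield F, (G : Set F) = differenceRatios S := by
  have hmon : ∀ m ∈ Submonoid.closure S, ∀ r ∈ differenceRatios S,
      m * r ∈ differenceRatios S := by
    intro m hm
    induction hm using Submonoid.closure_induction with
    | mem s hs => exact hmul s hs
    | one => simp
    | mul x y _ _ hx hy => intro r hr; rw [mul_assoc]; exact hx _ (hy _ hr)
  have hclos : ∀ g ∈ Subring.closure S, ∀ r ∈ differenceRatios S,
      g + r ∈ differenceRatios S := by
    intro g hg
    rw [Subring.mem_closure_iff] at hg
    induction hg using AddSubgroup.closure_induction with
    | mem m hm =>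
      intro r hr
      by_cases hm0 : m = 0
      · simpa [hm0] using hr
      -- Translation by a nonzero product $m$ of generators reduces to translation by $1$ through
      -- $m+r=m(1+m^{-1}r)$.
      · have h2 := hadd _ (inv_mul_mem_of_forall_mul_mem hm0 (hmon m hm) hr)
        have h3 := hmon m hm _ h2
        rwa [mul_add, mul_one, mul_inv_cancel_left₀ hm0] at h3
    | zero => simp
    | add x y _ _ hx hy => intro r hr; rw [add_assoc]; exact hx _ (hy _ hr)
    | neg x _ hx =>
      intro r hr
      have := neg_mem_differenceRatios (hx _ (neg_mem_differenceRatios hr))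
      simpa [add_comm] using this
  have hsub : ∀ g ∈ Subring.closure S, g ∈ differenceRatios S := fun g hg => by
    simpa using hclos g hg 0 (zero_mem_differenceRatios h0 h1)
  -- A finite subring of a field is a field, so the subring generated by $S$ also contains every
  -- difference ratio.
  have hpow : ∀ g ∈ Subring.closure S, g⁻¹ ∈ Subring.closure S := by
    intro g hg
    by_cases hg0 : g = 0
    · simp [hg0]
    · have := inv_mul_mem_of_forall_mul_mem (R := (Subring.closure S : Set F)) hg0
        (fun r hr => Subring.mul_mem _ hg hr) (Subring.one_mem _)
      simpa using this
  refine ⟨{ Subring.closure S with inv_mem' := hpow }, ?_⟩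
  ext r
  constructor
  · exact hsub r
  · rintro ⟨p, hp, q, hq, u, hu, v, hv, -, rfl⟩
    have hS : S ⊆ Subring.closure S := Subring.subset_closure
    rw [div_eq_mul_inv]
    exact Subring.mul_mem _ (Subring.sub_mem _ (hS hp) (hS hq))
      (hpow _ (Subring.sub_mem _ (hS hu) (hS hv)))

theorem mem_differenceRatios_self (h0 : 0 ∈ S) (h1 : 1 ∈ S) {s : F} (hs : s ∈ S) :
    s ∈ differenceRatios S :=
  ⟨s, hs, 0, h0, 1, h1, 0, h0, one_ne_zero, by simp⟩

theorem differenceRatios_subset_of_affine {T : Set F} {b l : F} (hl : l ≠ 0)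
    (h : ∀ x ∈ S, l * (x - b) ∈ T) : differenceRatios S ⊆ differenceRatios T := by
  rintro r ⟨p, hp, q, hq, u, hu, v, hv, huv, rfl⟩
  have huv' : u - v ≠ 0 := sub_ne_zero.2 huv
  refine ⟨_, h p hp, _, h q hq, _, h u hu, _, h v hv, ?_, ?_⟩
  · intro h
    exact huv (sub_left_injective (mul_left_cancel₀ hl h))
  · have h1 : l * (p - b) - l * (q - b) = l * (p - q) := by ring
    have h2 : l * (u - b) - l * (v - b) = l * (u - v) := by ring
    rw [h1, h2, mul_div_mul_left _ _ hl]

end DifferenceRatios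

/-! ### The pivot argument -/

section PivotBound

variable {F : Type*} [Field F] [DecidableEq F]

theorem collisions_smul (P : Finset (F × F)) {a b r : F} (ha : a ≠ 0) (hr : r = b / a) :
    collisions P (fun x => a * x.1 + b * x.2) = collisions P (fun x => x.1 + r * x.2) := by
  unfold collisions
  congr 1
  refine filter_congr fun x _ => ?_
  have h : ∀ y : F × F, a * y.1 + b * y.2 = a * (y.1 + r * y.2) := by
    intro y; rw [hr]; field_simp
  show a * x.1.1 + b * x.1.2 = a * x.2.1 + b * x.2.2 ↔ _
  rw [h, h]
  exact mul_right_inj' ha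

/-- A nontrivial collision $a+rb=c+rd$ would give $r=(c-a)/(b-d)$, so the map is injective. -/
theorem collisions_le_of_notMem_differenceRatios (S : Finset F) {r : F}
    (hr : r ∉ differenceRatios (S : Set F)) :
    collisions (S ×ˢ S) (fun x : F × F => x.1 + r * x.2) ≤ #S ^ 2 := by
  refine (collisions_le_of_injOn _ _ ?_).trans (by rw [card_product, sq])
  rintro ⟨a, b⟩ hx ⟨c, d⟩ hy h
  simp only [coe_product, Set.mem_prod, mem_coe] at hx hy
  simp only at h
  by_cases hbd : b = d
  · subst hbd
    simpa using h
  · refine absurd ⟨c, hy.1, a, hx.1, b, hx.2, d, hy.2, hbd, ?_⟩ hr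
    rw [eq_div_iff (sub_ne_zero.2 hbd)]
    linear_combination h

/-- A pair of equal points collides for every $r$, a pair of distinct points for at most one $r$. -/
theorem sum_collisions_le (S G : Finset F) :
    ∑ r ∈ G, collisions (S ×ˢ S) (fun x : F × F => x.1 + r * x.2) ≤ #G * #S ^ 2 + #S ^ 4 := by
  have hswap : ∑ r ∈ G, collisions (S ×ˢ S) (fun x : F × F => x.1 + r * x.2) =
      ∑ p ∈ (S ×ˢ S) ×ˢ (S ×ˢ S), #{r ∈ G | p.1.1 + r * p.1.2 = p.2.1 + r * p.2.2} :=
    Finset.sum_card_bipartiteAbove_eq_sum_card_bipartiteBelow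
      (fun r (p : (F × F) × F × F) => p.1.1 + r * p.1.2 = p.2.1 + r * p.2.2)
  rw [hswap]
  have hle : ∀ p ∈ (S ×ˢ S) ×ˢ (S ×ˢ S),
      #{r ∈ G | p.1.1 + r * p.1.2 = p.2.1 + r * p.2.2} ≤ (if p.1 = p.2 then #G else 0) + 1 := by
    rintro ⟨⟨a, b⟩, c, d⟩ _
    by_cases h : (a, b) = (c, d)
    · simp only [h, if_true]
      exact (card_filter_le _ _).trans (Nat.le_succ _)
    · simp only [h, if_false, zero_add]
      rw [card_le_one]
      intro r hr r' hr'
      simp only [mem_filter] at hr hr'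
      have hbd : b - d ≠ 0 := by
        intro hbd
        have hbd := sub_eq_zero.1 hbd
        subst hbd
        exact h (by simpa using hr.2)
      have : (b - d) * r = (b - d) * r' := by linear_combination hr.2 - hr'.2
      exact mul_left_cancel₀ hbd this
  refine (Finset.sum_le_sum hle).trans ?_
  rw [Finset.sum_add_distrib, ← Finset.sum_filter, Finset.sum_const, Finset.sum_const, smul_eq_mul,
    smul_eq_mul, mul_one]
  have hdiag : #{p ∈ (S ×ˢ S) ×ˢ (S ×ˢ S) | p.1 = p.2} ≤ #S ^ 2 := by
    rw [sq, ← card_product]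
    refine Finset.card_le_card_of_injOn Prod.fst ?_ ?_
    · intro p hp
      exact (mem_product.1 (mem_filter.1 hp).1).1
    · rintro ⟨p, p'⟩ hp ⟨q, q'⟩ hq h
      have h1 := (mem_filter.1 hp).2
      have h2 := (mem_filter.1 hq).2
      simp only at h h1 h2
      rw [← h1, ← h2, h]
  rw [card_product, card_product]
  calc _ ≤ #S ^ 2 * #G + #S * #S * (#S * #S) := by gcongr
    _ = _ := by ring

variable [Finite F]

theorem exists_mem_subfield_collisions_le (S : Finset F) (G : Subfield F) :
    ∃ r ∈ G, collisions (S ×ˢ S) (fun x : F × F => x.1 + r * x.2) * Nat.card G ≤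
      Nat.card G * #S ^ 2 + #S ^ 4 := by
  classical
  have hfin : (G : Set F).Finite := Set.toFinite _
  have hcard : #hfin.toFinset = Nat.card G := by
    rw [← Set.ncard_eq_toFinset_card _ hfin]; rfl
  have hne : hfin.toFinset.Nonempty := ⟨0, by simp⟩
  have hsum := sum_collisions_le S hfin.toFinset
  obtain ⟨r, hr, hmin⟩ := Finset.exists_min_image hfin.toFinset
    (fun r => collisions (S ×ˢ S) (fun x : F × F => x.1 + r * x.2)) hne
  refine ⟨r, by simpa using hr, ?_⟩
  have h := Finset.card_nsmul_le_sum _ _ _ hmin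
  rw [smul_eq_mul] at h
  rw [mul_comm, ← hcard]
  exact h.trans hsum

/-- The pivot $r$ must have few collisions on $S\times S$ and be expressible through good
multipliers. A failure of closure of the difference ratios provides one with no nontrivial
collision, and then $G=\top$ serves; if closure holds, averaging over the resulting subfield
provides one. -/
theorem pivot_bound {X S : Finset F} {w : ℝ} {b l : F} (hw : 0 < w) (hSX : S ⊆ X)
    (hS : S.Nonempty) (hl : l ≠ 0) (hgood : ∀ x ∈ S, NearlyPreserves X w (l * (x - b))) :
    ∃ G : Subfield F, (∀ x ∈ S, l * (x - b) ∈ G) ∧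
      (w / #(X - X) : ℝ) ^ 6 * (#S : ℝ) ^ 2 * Nat.card G ≤
        (Nat.card G + (#S : ℝ) ^ 2) * #(3 • X - 3 • X) := by
  -- The subfield criterion needs $0$ and $1$; both preserve $X$ up to translation, so adjoining
  -- them costs nothing.
  set T : Set F := insert 0 (insert 1 ((fun x => l * (x - b)) '' S)) with hT
  have h0 : (0 : F) ∈ T := Set.mem_insert _ _
  have h1 : (1 : F) ∈ T := Set.mem_insert_of_mem _ (Set.mem_insert _ _)
  have hST : ∀ x ∈ (S : Set F), l * (x - b) ∈ T := fun x hx =>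
    Set.mem_insert_of_mem _ (Set.mem_insert_of_mem _ ⟨x, hx, rfl⟩)
  have hwX : w ≤ #X := by
    obtain ⟨x, hx⟩ := hS
    obtain ⟨t, ht⟩ := hgood x hx
    refine ht.trans ?_
    exact_mod_cast card_filter_le _ _
  have hTgood : ∀ s ∈ T, NearlyPreserves X w s := by
    rintro s (rfl | rfl | ⟨x, hx, rfl⟩)
    · obtain ⟨x, hx⟩ := hS
      refine ⟨x, ?_⟩
      simpa [hSX hx] using hwX
    · refine ⟨0, ?_⟩
      simpa using hwX
    · exact hgood x hx
  have hSS : (0 : ℝ) < #S := by exact_mod_cast hS.card_pos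
  have hspread : ∀ {a c r : F} {N : ℝ}, a ≠ 0 → r = c / a →
      (w / #(X - X) : ℝ) ^ 6 * spread (S ×ˢ S) (fun x => a * x.1 + c * x.2) ≤
        #(3 • X - 3 • X) →
      (collisions (S ×ˢ S) (fun x : F × F => x.1 + r * x.2) : ℝ) ≤ (#S : ℝ) ^ 2 * N →
      (w / #(X - X) : ℝ) ^ 6 * (#S : ℝ) ^ 2 ≤ N * #(3 • X - 3 • X) := by
    intro a c r N ha hr h hN
    have hpos : (0 : ℝ) < collisions (S ×ˢ S) (fun x : F × F => x.1 + r * x.2) := by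
      exact_mod_cast (hS.product hS).card_pos.trans_le (card_le_collisions _ _)
    unfold spread at h
    rw [collisions_smul _ ha hr, card_product, ← mul_div_assoc, div_le_iff₀ hpos] at h
    push_cast at h
    have h2 : (w / #(X - X) : ℝ) ^ 6 * ((#S : ℝ) * #S) ^ 2 ≤
        #(3 • X - 3 • X) * ((#S : ℝ) ^ 2 * N) := h.trans (by gcongr)
    have h3 : (0 : ℝ) < (#S : ℝ) ^ 2 := by positivity
    refine le_of_mul_le_mul_right ?_ h3
    linarith
  have htop : ∀ {a c r : F}, a ≠ 0 → r = c / a →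
      (w / #(X - X) : ℝ) ^ 6 * spread (S ×ˢ S) (fun x => a * x.1 + c * x.2) ≤
        #(3 • X - 3 • X) → r ∉ differenceRatios T →
      ∃ G : Subfield F, (∀ x ∈ S, l * (x - b) ∈ G) ∧
      (w / #(X - X) : ℝ) ^ 6 * (#S : ℝ) ^ 2 * Nat.card G ≤
        (Nat.card G + (#S : ℝ) ^ 2) * #(3 • X - 3 • X) := by
    intro a c r ha hr h hrT
    have hc := collisions_le_of_notMem_differenceRatios S
      (fun hmem => hrT (differenceRatios_subset_of_affine hl hST hmem))
    have h2 := hspread (N := 1) ha hr h (by rw [mul_one]; exact_mod_cast hc)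
    refine ⟨⊤, fun x _ => Subfield.mem_top _, ?_⟩
    have h3 : (0 : ℝ) ≤ (#S : ℝ) ^ 2 * #(3 • X - 3 • X) := by positivity
    have h4 := mul_le_mul_of_nonneg_right h2 (Nat.cast_nonneg (α := ℝ) (Nat.card (⊤ : Subfield F)))
    linarith
  by_cases hadd : ∀ r ∈ differenceRatios T, 1 + r ∈ differenceRatios T
  · by_cases hmul : ∀ s ∈ T, ∀ r ∈ differenceRatios T, s * r ∈ differenceRatios T
    · obtain ⟨G, hG⟩ := exists_subfield_eq_differenceRatios h0 h1 hadd hmul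
      refine ⟨G, fun x hx => ?_, ?_⟩
      · rw [← SetLike.mem_coe, hG]
        exact mem_differenceRatios_self h0 h1 (hST x hx)
      obtain ⟨r, hr, hcoll⟩ := exists_mem_subfield_collisions_le S G
      rw [← SetLike.mem_coe, hG] at hr
      obtain ⟨p, hp, q, hq, u, hu, v, hv, huv, hr⟩ := hr
      have hGpos : (0 : ℝ) < Nat.card G := by exact_mod_cast Nat.card_pos
      -- Here the pivot is itself a difference ratio, so the multiplicative bound applies with
      -- $s=1$.
      have h := hspread (N := (Nat.card G + (#S : ℝ) ^ 2) / Nat.card G) (r := r)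
        (sub_ne_zero.2 huv) (by rw [hr, one_mul])
        (spread_mul_bound hw hSX hS (hTgood p hp) (hTgood q hq) (hTgood u hu) (hTgood v hv)
          (hTgood 1 h1)) (by
            rw [← mul_div_assoc, le_div_iff₀ hGpos]
            have : (collisions (S ×ˢ S) (fun x : F × F => x.1 + r * x.2) : ℝ) * Nat.card G ≤
              Nat.card G * (#S : ℝ) ^ 2 + (#S : ℝ) ^ 4 := by exact_mod_cast hcoll
            linarith)
      rw [div_mul_eq_mul_div, le_div_iff₀ hGpos] at h
      exact h
    · push Not at hmul
      obtain ⟨s, hs, r, ⟨p, hp, q, hq, u, hu, v, hv, huv, rfl⟩, hr⟩ := hmul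
      exact htop (sub_ne_zero.2 huv) (by rw [mul_div_assoc])
        (spread_mul_bound hw hSX hS (hTgood p hp) (hTgood q hq) (hTgood u hu) (hTgood v hv)
          (hTgood s hs)) hr
  · push Not at hadd
    obtain ⟨r, ⟨p, hp, q, hq, u, hu, v, hv, huv, rfl⟩, hr⟩ := hadd
    have huv' := sub_ne_zero.2 huv
    exact htop huv' (by field_simp)
        (spread_add_bound hw hSX hS (hTgood p hp) (hTgood q hq) (hTgood u hu) (hTgood v hv)) hr

end PivotBound

/-! ### Popularity arguments and a Balog–Szemerédi–Gowers lemma -/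

section Counting

variable {ι κ α : Type*}

theorem sum_card_filter_comm (I : Finset ι) (A : Finset α) (rel : ι → α → Prop)
    [∀ i x, Decidable (rel i x)] :
    ∑ i ∈ I, (#{x ∈ A | rel i x} : ℝ) = ∑ x ∈ A, (#{i ∈ I | rel i x} : ℝ) := by
  have := Finset.sum_card_bipartiteAbove_eq_sum_card_bipartiteBelow (s := I) (t := A) rel
  simp only [bipartiteAbove, bipartiteBelow] at this
  exact_mod_cast this

theorem sum_card_fibers_le [DecidableEq κ] (P : Finset ι) (f : ι → κ) (J : Finset κ) :
    ∑ j ∈ J, #{p ∈ P | f p = j} ≤ #P := by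
  rw [← card_filter_add_card_filter_not (s := P) (fun p => f p ∈ J),
    Finset.card_eq_sum_card_fiberwise (f := f) (s := {p ∈ P | f p ∈ J}) (t := J)
      fun p hp => (mem_filter.1 hp).2]
  refine (Finset.sum_le_sum fun j hj => card_le_card fun p hp => ?_).trans (Nat.le_add_right _ _)
  simp only [mem_filter] at hp ⊢
  exact ⟨⟨hp.1, hp.2 ▸ hj⟩, hp.2⟩

theorem exists_large_fiber [DecidableEq κ] (P : Finset ι) (hP : P.Nonempty) (J : Finset κ)
    (f : ι → κ) (hf : ∀ p ∈ P, f p ∈ J) {m c : ℝ} (hm : #J ≤ m) (hc : 0 ≤ c) (h : c * m ≤ #P) :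
    ∃ j ∈ J, c ≤ #{p ∈ P | f p = j} := by
  have hJ : J.Nonempty := hP.imp' f hf
  have hsum : (#P : ℝ) = ∑ j ∈ J, (#{p ∈ P | f p = j} : ℝ) := by
    exact_mod_cast Finset.card_eq_sum_card_fiberwise hf
  refine Finset.exists_le_of_sum_le (f := fun _ => c) hJ ?_
  rw [← hsum, sum_const, nsmul_eq_mul, mul_comm]
  exact (mul_le_mul_of_nonneg_left hm hc).trans h

theorem mul_card_le_card_filter (X : Finset α) (f : α → ℝ) {M c : ℝ} (hM : 0 < M) (hc : 0 ≤ c)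
    (hf : ∀ x ∈ X, f x ≤ M) (h : 2 * c * M * #X ≤ ∑ x ∈ X, f x) :
    c * #X ≤ #{x ∈ X | c * M ≤ f x} := by
  have h1 : ∑ x ∈ X, f x ≤ ∑ x ∈ X, ((if c * M ≤ f x then M else 0) + c * M) := by
    refine Finset.sum_le_sum fun x hx => ?_
    split_ifs with h
    · have := hf x hx
      have := mul_nonneg hc hM.le
      linarith
    · linarith
  rw [sum_add_distrib, ← sum_filter, sum_const, sum_const, nsmul_eq_mul, nsmul_eq_mul] at h1
  have h2 : c * #X * M ≤ #{x ∈ X | c * M ≤ f x} * M := by linarith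
  exact le_of_mul_le_mul_right h2 hM

theorem sum_filter_ge_of_sum_ge (X : Finset α) (f : α → ℝ) {c N : ℝ} (hN : #X ≤ N) (hc : 0 ≤ c)
    (h : 2 * c * N ≤ ∑ x ∈ X, f x) : c * N ≤ ∑ x ∈ X with c ≤ f x, f x := by
  have h1 : ∑ x ∈ X, f x ≤ ∑ x ∈ X, ((if c ≤ f x then f x else 0) + c) := by
    refine Finset.sum_le_sum fun x hx => ?_
    split_ifs with h <;> linarith
  rw [sum_add_distrib, ← sum_filter, sum_const, nsmul_eq_mul] at h1
  have := mul_le_mul_of_nonneg_right hN hc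
  linarith

/-- Dependent selection: a pair with few common indices rarely lies in the neighbourhood $N_i$ of an
index $i$. Summed over $i$, the squares $|N_i|^2$ total at least $\tau^2m|A|^2/4$, while the bad
pairs total at most $\tau^2m|A|^2/128$. The weight $16$ uses up half of the former, leaving
$\tau^2|A|^2/8$ on average. -/
theorem exists_index_few_bad_pairs [DecidableEq α] (I : Finset ι) (A : Finset α)
    (rel : ι → α → Prop) [∀ i x, Decidable (rel i x)] {m τ : ℝ} (hI : #I ≤ m) (hm : 0 < m)
    (hτ : 0 < τ) (hA : A.Nonempty) (h : τ * m * #A ≤ ∑ i ∈ I, (#{x ∈ A | rel i x} : ℝ)) :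
    ∃ N ⊆ A, (∀ x ∈ N, τ / 2 * m ≤ #{i ∈ I | rel i x}) ∧
      16 * (#{p ∈ N ×ˢ N | (#{i ∈ I | rel i p.1 ∧ rel i p.2} : ℝ) < τ ^ 2 / 128 * m} : ℝ) +
        τ ^ 2 / 8 * (#A : ℝ) ^ 2 ≤ (#N : ℝ) ^ 2 := by
  have hn : (0 : ℝ) < #A := by exact_mod_cast hA.card_pos
  set deg : α → ℝ := fun x => #{i ∈ I | rel i x} with hdeg
  set codeg : α → α → ℝ := fun x z => #{i ∈ I | rel i x ∧ rel i z} with hcodeg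
  set η : ℝ := τ ^ 2 / 128 * m with hη
  set A' : Finset α := {x ∈ A | τ / 2 * m ≤ deg x} with hA'
  set N : ι → Finset α := fun i => {x ∈ A' | rel i x} with hN
  set B : ι → Finset (α × α) := fun i => {p ∈ N i ×ˢ N i | codeg p.1 p.2 < η} with hB
  have hsumdeg : ∑ i ∈ I, (#{x ∈ A | rel i x} : ℝ) = ∑ x ∈ A, deg x :=
    sum_card_filter_comm I A rel
  have hsumN : ∑ i ∈ I, (#(N i) : ℝ) = ∑ x ∈ A', deg x :=
    sum_card_filter_comm I A' rel
  have hN1 : τ / 2 * m * #A ≤ ∑ i ∈ I, (#(N i) : ℝ) := by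
    rw [hsumN]
    refine sum_filter_ge_of_sum_ge A deg le_rfl (by positivity) ?_
    rw [← hsumdeg]
    linarith
  have hIne : I.Nonempty := by
    rw [nonempty_iff_ne_empty]
    rintro rfl
    have : 0 < τ / 2 * m * #A := by positivity
    simp only [sum_empty] at hN1
    linarith
  have hN2 : τ ^ 2 / 4 * m * (#A : ℝ) ^ 2 ≤ ∑ i ∈ I, (#(N i) : ℝ) ^ 2 := by
    have hcs := sq_sum_le_card_mul_sum_sq (s := I) (f := fun i => (#(N i) : ℝ))
    have h1 : (τ / 2 * m * #A) ^ 2 ≤ (∑ i ∈ I, (#(N i) : ℝ)) ^ 2 := by gcongr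
    have h2 : (#I : ℝ) * ∑ i ∈ I, (#(N i) : ℝ) ^ 2 ≤ m * ∑ i ∈ I, (#(N i) : ℝ) ^ 2 :=
      mul_le_mul_of_nonneg_right hI (sum_nonneg fun _ _ => by positivity)
    refine le_of_mul_le_mul_left ?_ hm
    calc m * (τ ^ 2 / 4 * m * (#A : ℝ) ^ 2) = (τ / 2 * m * #A) ^ 2 := by ring
      _ ≤ _ := h1.trans (hcs.trans h2)
  have hB1 : ∑ i ∈ I, (#(B i) : ℝ) ≤ η * (#A : ℝ) ^ 2 := by
    have h1 : ∀ i, B i ⊆ {p ∈ {p ∈ A ×ˢ A | codeg p.1 p.2 < η} | rel i p.1 ∧ rel i p.2} := by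
      intro i p hp
      simp only [hB, hN, hA', mem_filter, mem_product] at hp ⊢
      tauto
    calc ∑ i ∈ I, (#(B i) : ℝ)
        ≤ ∑ i ∈ I, (#{p ∈ {p ∈ A ×ˢ A | codeg p.1 p.2 < η} | rel i p.1 ∧ rel i p.2} : ℝ) :=
          Finset.sum_le_sum fun i _ => by exact_mod_cast card_le_card (h1 i)
      _ = ∑ p ∈ {p ∈ A ×ˢ A | codeg p.1 p.2 < η}, codeg p.1 p.2 :=
          sum_card_filter_comm I _ (fun i (p : α × α) => rel i p.1 ∧ rel i p.2)
      _ ≤ ∑ p ∈ {p ∈ A ×ˢ A | codeg p.1 p.2 < η}, η :=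
          Finset.sum_le_sum fun p hp => (mem_filter.1 hp).2.le
      _ ≤ η * (#A : ℝ) ^ 2 := by
          rw [sum_const, nsmul_eq_mul, mul_comm]
          have : (#{p ∈ A ×ˢ A | codeg p.1 p.2 < η} : ℝ) ≤ (#A : ℝ) ^ 2 := by
            rw [sq]
            exact_mod_cast (card_filter_le _ _).trans (card_product A A).le
          gcongr
  obtain ⟨i, hi, hbig⟩ : ∃ i ∈ I, 16 * (#(B i) : ℝ) + τ ^ 2 / 8 * (#A : ℝ) ^ 2 ≤
      (#(N i) : ℝ) ^ 2 := by
    refine Finset.exists_le_of_sum_le hIne ?_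
    rw [sum_add_distrib, ← mul_sum, sum_const, nsmul_eq_mul]
    have h1 : (#I : ℝ) * (τ ^ 2 / 8 * (#A : ℝ) ^ 2) ≤ m * (τ ^ 2 / 8 * (#A : ℝ) ^ 2) := by gcongr
    rw [hη] at hB1
    linarith
  exact ⟨N i, (filter_subset _ _).trans (filter_subset _ _),
    fun x hx => (mem_filter.1 (mem_filter.1 hx).1).2, hbig⟩

/-- A form of the Balog–Szemerédi–Gowers argument: from a dense family of subsets of `A`, indexed by
at most `m` indices, one extracts a large `X ⊆ A` any two elements of which are joined by many paths
of length two through pairs lying in many common members of the family. -/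
theorem exists_subset_popular_paths (I : Finset ι) (A : Finset α) (rel : ι → α → Prop)
    [∀ i x, Decidable (rel i x)] {m τ : ℝ} (hI : #I ≤ m) (hm : 0 < m) (hτ : 0 < τ)
    (hA : A.Nonempty) (h : τ * m * #A ≤ ∑ i ∈ I, (#{x ∈ A | rel i x} : ℝ)) :
    ∃ X ⊆ A, τ / 4 * #A ≤ #X ∧ (∀ x ∈ X, τ / 2 * m ≤ #{i ∈ I | rel i x}) ∧
      ∀ x ∈ X, ∀ y ∈ X, τ / 6 * #A ≤ #{z ∈ A | τ ^ 2 / 128 * m ≤ #{i ∈ I | rel i x ∧ rel i z} ∧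
        τ ^ 2 / 128 * m ≤ #{i ∈ I | rel i z ∧ rel i y}} := by
  classical
  obtain ⟨N, hNA, hdeg, hbig⟩ := exists_index_few_bad_pairs I A rel hI hm hτ hA h
  set codeg : α → α → ℝ := fun x z => #{i ∈ I | rel i x ∧ rel i z} with hcodeg
  set η : ℝ := τ ^ 2 / 128 * m with hη
  set B : Finset (α × α) := {p ∈ N ×ˢ N | codeg p.1 p.2 < η} with hB
  have hn : (0 : ℝ) < #A := by exact_mod_cast hA.card_pos
  have hNlarge : τ / 3 * #A ≤ #N := by
    have h1 : (0 : ℝ) ≤ #B := by positivity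
    have h2 : 0 ≤ τ ^ 2 * (#A : ℝ) ^ 2 := by positivity
    refine le_of_sq_le_sq ?_ (by positivity)
    nlinarith
  have hNpos : (0 : ℝ) < #N := lt_of_lt_of_le (by positivity) hNlarge
  -- By Markov, all but a quarter of $N$ have at most $|N|/4$ bad partners. Two such elements share
  -- at least $|N|/2\ge\tau|A|/6$ good partners.
  set bad : α → Finset α := fun x => {z ∈ N | codeg x z < η} with hbad
  set X : Finset α := {x ∈ N | 4 * (#(bad x) : ℝ) ≤ #N} with hX
  have hXN : X ⊆ N := filter_subset _ _
  have hXcard : (3 / 4 : ℝ) * #N ≤ #X := by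
    have h1 : ((N \ X).card : ℝ) * (#N / 4) ≤ #B := by
      have h2 : (#B : ℝ) = ∑ x ∈ N, (#(bad x) : ℝ) := by
        have : #B = ∑ x ∈ N, #(bad x) := by
          simp only [hB, hbad, card_filter, sum_product]
        exact_mod_cast this
      rw [h2, ← nsmul_eq_mul, ← sum_const]
      calc _ ≤ ∑ x ∈ N \ X, (#(bad x) : ℝ) := by
            refine Finset.sum_le_sum fun x hx => ?_
            rw [mem_sdiff, hX, mem_filter, not_and] at hx
            have := hx.2 hx.1
            linarith
        _ ≤ _ := Finset.sum_le_sum_of_subset_of_nonneg sdiff_subset fun _ _ _ => by positivity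
    have h3 : ((N \ X).card : ℝ) = #N - #X := by
      rw [card_sdiff_of_subset hXN, Nat.cast_sub (card_le_card hXN)]
    have h4 : 0 ≤ τ ^ 2 / 8 * (#A : ℝ) ^ 2 := by positivity
    rw [h3] at h1
    by_contra hcon
    push Not at hcon
    nlinarith
  refine ⟨X, hXN.trans hNA, by linarith, ?_, ?_⟩
  · intro x hx
    exact hdeg x (hXN hx)
  · intro x hx y hy
    have hsub : N \ (bad x ∪ bad y) ⊆ {z ∈ A | η ≤ codeg x z ∧ η ≤ codeg z y} := by
      intro z hz
      simp only [mem_sdiff, mem_union, not_or, hbad, mem_filter, not_and, not_lt] at hz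
      rw [mem_filter]
      refine ⟨hNA hz.1, hz.2.1 hz.1, ?_⟩
      have := hz.2.2 hz.1
      simp only [hcodeg] at this ⊢
      simpa only [and_comm] using this
    have h1 : (#N : ℝ) ≤ #(N \ (bad x ∪ bad y)) + (#(bad x) + #(bad y)) := by
      have h2 := card_le_card_sdiff_add_card (s := N) (t := bad x ∪ bad y)
      have h3 := card_union_le (bad x) (bad y)
      exact_mod_cast h2.trans (by omega)
    have h4 : (#(N \ (bad x ∪ bad y)) : ℝ) ≤ #{z ∈ A | η ≤ codeg x z ∧ η ≤ codeg z y} := by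
      exact_mod_cast card_le_card hsub
    have h5 := (mem_filter.1 hx).2
    have h6 := (mem_filter.1 hy).2
    linarith

/-- Each difference is $x-y=(x-z)+(z-y)$ for at least $p$ choices of $z$, and each summand has at
least $k$ representations. So every element of $X-X$ uses at least $pk^2$ of the $|E|^2$ pairs. -/
theorem card_sub_mul_le_sq_card {G : Type*} [AddCommGroup G] [DecidableEq G] (X A : Finset G)
    (E : Finset ι) (δ : ι → G) {p k : ℝ} (hk : 0 ≤ k)
    (h : ∀ x ∈ X, ∀ y ∈ X, p ≤ #{z ∈ A | k ≤ #{e ∈ E | δ e = x - z} ∧ k ≤ #{e ∈ E | δ e = z - y}}) :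
    #(X - X) * (p * k ^ 2) ≤ (#E : ℝ) ^ 2 := by
  have hfib : ∀ d ∈ X - X, p * k ^ 2 ≤ #{e ∈ E ×ˢ E | δ e.1 + δ e.2 = d} := by
    intro d hd
    obtain ⟨x, hx, y, hy, rfl⟩ := mem_sub.1 hd
    set Z := {z ∈ A | k ≤ #{e ∈ E | δ e = x - z} ∧ k ≤ #{e ∈ E | δ e = z - y}} with hZ
    have h1 : ∑ z ∈ Z, k ^ 2 ≤
        ∑ z ∈ Z, (#{e ∈ {e ∈ E ×ˢ E | δ e.1 + δ e.2 = x - y} | x - δ e.1 = z} : ℝ) := by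
      refine Finset.sum_le_sum fun z hz => ?_
      have hz := (mem_filter.1 hz).2
      have h2 : {e ∈ E | δ e = x - z} ×ˢ {e ∈ E | δ e = z - y} ⊆
          {e ∈ {e ∈ E ×ˢ E | δ e.1 + δ e.2 = x - y} | x - δ e.1 = z} := by
        intro e he
        simp only [mem_filter, mem_product] at he ⊢
        refine ⟨⟨⟨he.1.1, he.2.1⟩, ?_⟩, ?_⟩
        · rw [he.1.2, he.2.2]; abel
        · rw [he.1.2]; abel
      have h3 := card_le_card h2
      rw [card_product] at h3
      calc k ^ 2 = k * k := sq k
        _ ≤ #{e ∈ E | δ e = x - z} * #{e ∈ E | δ e = z - y} :=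
            mul_le_mul hz.1 hz.2 hk (hk.trans hz.1)
        _ ≤ _ := by exact_mod_cast h3
    have h4 : ∑ z ∈ Z, #{e ∈ {e ∈ E ×ˢ E | δ e.1 + δ e.2 = x - y} | x - δ e.1 = z} ≤
        #{e ∈ E ×ˢ E | δ e.1 + δ e.2 = x - y} :=
      sum_card_fibers_le _ _ _
    rw [sum_const, nsmul_eq_mul] at h1
    calc p * k ^ 2 ≤ #Z * k ^ 2 := by gcongr; exact h x hx y hy
      _ ≤ _ := h1.trans (by exact_mod_cast h4)
  have h5 : ∑ d ∈ X - X, #{e ∈ E ×ˢ E | δ e.1 + δ e.2 = d} ≤ #(E ×ˢ E) :=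
    sum_card_fibers_le _ _ _
  have h6 := Finset.sum_le_sum hfib
  rw [sum_const, nsmul_eq_mul] at h6
  refine h6.trans ?_
  rw [sq]
  rw [card_product] at h5
  exact_mod_cast h5

end Counting

/-! ### Triples with equal ratios and the three selections -/

section Triples

variable {F : Type*} [Field F] [DecidableEq F]

/-- Triples of pairwise distinct elements of `A`. -/
def distinctTriples (A : Finset F) : Finset (F × F × F) :=
  {t ∈ A ×ˢ A ×ˢ A | t.1 ≠ t.2.1 ∧ t.1 ≠ t.2.2 ∧ t.2.1 ≠ t.2.2}

/-- The ratio `(a₂ - a₁) / (a₃ - a₁)` of the triple `(a₁, a₂, a₃)`. -/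
def simpleRatio (t : F × F × F) : F := (t.2.1 - t.1) / (t.2.2 - t.1)

/-- Pairs of triples in `P × Q` with equal ratios. -/
def similarPairs (P Q : Finset (F × F × F)) : Finset ((F × F × F) × (F × F × F)) :=
  {p ∈ P ×ˢ Q | simpleRatio p.1 = simpleRatio p.2}

variable {A : Finset F}

omit [Field F] in
theorem mem_distinctTriples {a b c : F} : (a, b, c) ∈ distinctTriples A ↔
    (a ∈ A ∧ b ∈ A ∧ c ∈ A) ∧ a ≠ b ∧ a ≠ c ∧ b ≠ c := by
  simp [distinctTriples]

theorem mem_similarPairs {P Q : Finset (F × F × F)} {p : (F × F × F) × (F × F × F)} :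
    p ∈ similarPairs P Q ↔ (p.1 ∈ P ∧ p.2 ∈ Q) ∧ simpleRatio p.1 = simpleRatio p.2 := by
  simp [similarPairs]

omit [Field F] in
theorem card_distinctTriples_le (A : Finset F) : #(distinctTriples A) ≤ #A ^ 3 := by
  refine (card_filter_le _ _).trans ?_
  rw [card_product, card_product]
  exact (by ring : #A * (#A * #A) = #A ^ 3).le

theorem simpleRatio_ne_zero {t : F × F × F} (ht : t ∈ distinctTriples A) : simpleRatio t ≠ 0 := by
  obtain ⟨a, b, c⟩ := t
  obtain ⟨-, h1, h2, -⟩ := mem_distinctTriples.1 ht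
  exact div_ne_zero (sub_ne_zero.2 h1.symm) (sub_ne_zero.2 h2.symm)

theorem simpleRatio_ne_one {t : F × F × F} (ht : t ∈ distinctTriples A) : simpleRatio t ≠ 1 := by
  obtain ⟨a, b, c⟩ := t
  obtain ⟨-, -, h2, h3⟩ := mem_distinctTriples.1 ht
  intro h
  have h := (div_eq_one_iff_eq (sub_ne_zero.2 h2.symm)).1 h
  exact h3 (sub_left_injective h)

theorem middle_eq_of_simpleRatio {t : F × F × F} {r : F} (ht : t ∈ distinctTriples A)
    (h : simpleRatio t = r) : t.2.1 = (1 - r) * t.1 + r * t.2.2 := by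
  obtain ⟨a, b, c⟩ := t
  obtain ⟨-, -, h2, -⟩ := mem_distinctTriples.1 ht
  have h2 := sub_ne_zero.2 h2.symm
  subst h
  simp only [simpleRatio]
  field_simp
  ring

theorem first_eq_of_simpleRatio {s t : F × F × F} (hs : s ∈ distinctTriples A)
    (ht : t ∈ distinctTriples A) (h : simpleRatio s = simpleRatio t) (h2 : s.2.1 = t.2.1)
    (h3 : s.2.2 = t.2.2) : s = t := by
  have e1 := middle_eq_of_simpleRatio hs h
  have e2 := middle_eq_of_simpleRatio ht rfl
  have h1 : s.1 = t.1 := by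
    rw [h2, h3] at e1
    exact mul_left_cancel₀ (sub_ne_zero.2 (simpleRatio_ne_one ht).symm)
      (by linear_combination e2 - e1)
  exact Prod.ext h1 (Prod.ext h2 h3)

theorem third_eq_of_simpleRatio {s t : F × F × F} (hs : s ∈ distinctTriples A)
    (ht : t ∈ distinctTriples A) (h : simpleRatio s = simpleRatio t) (h1 : s.1 = t.1)
    (h2 : s.2.1 = t.2.1) : s = t := by
  have e1 := middle_eq_of_simpleRatio hs h
  have e2 := middle_eq_of_simpleRatio ht rfl
  have h3 : s.2.2 = t.2.2 := by
    rw [h1, h2] at e1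
    exact mul_left_cancel₀ (simpleRatio_ne_zero ht) (by linear_combination e2 - e1)
  exact Prod.ext h1 (Prod.ext h2 h3)

/-- First selection: a large subset of `A` with few differences all of whose elements occur
often as the last entry of a triple similar to another one. -/
theorem exists_subset_few_differences {τ : ℝ} (hτ : 0 < τ) (hA : A.Nonempty)
    (h : τ * (#A : ℝ) ^ 5 ≤ #(similarPairs (distinctTriples A) (distinctTriples A))) :
    ∃ X ⊆ A, τ / 4 * #A ≤ #X ∧
      (∀ x ∈ X, τ / 2 * (#A : ℝ) ^ 4 ≤
        #{p ∈ similarPairs (distinctTriples A) (distinctTriples A) | p.2.2.2 = x}) ∧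
      #(X - X) * (τ / 6 * #A * (τ ^ 2 / 128 * (#A : ℝ) ^ 4) ^ 2) ≤ ((#A : ℝ) ^ 5) ^ 2 := by
  classical
  set T := distinctTriples A with hT
  -- An index is a triple $t$, supplying the ratio, together with a middle entry $v$. Since ratio,
  -- middle and last entry determine the first, each similar pair yields its own incidence.
  set rel : (F × F × F) × F → F → Prop := fun i x =>
    ∃ a, (a, i.2, x) ∈ T ∧ simpleRatio (a, i.2, x) = simpleRatio i.1 with hrel
  have hn : (0 : ℝ) < #A := by exact_mod_cast hA.card_pos
  have hTcard : (#T : ℝ) ≤ (#A : ℝ) ^ 3 := by exact_mod_cast card_distinctTriples_le A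
  have hI : (#(T ×ˢ A) : ℝ) ≤ (#A : ℝ) ^ 4 := by
    rw [card_product]
    push_cast
    calc (#T : ℝ) * #A ≤ (#A : ℝ) ^ 3 * #A := by gcongr
      _ = _ := by ring
  have hsum : τ * (#A : ℝ) ^ 4 * #A ≤ ∑ i ∈ T ×ˢ A, (#{x ∈ A | rel i x} : ℝ) := by
    have h1 : #(similarPairs T T) ≤ ∑ i ∈ T ×ˢ A, #{x ∈ A | rel i x} := by
      rw [← card_sigma]
      refine Finset.card_le_card_of_injOn (fun p => ⟨(p.1, p.2.2.1), p.2.2.2⟩) ?_ ?_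
      · rintro ⟨t, a, v, x⟩ hp
        obtain ⟨⟨h1, h2⟩, h3⟩ := mem_similarPairs.1 hp
        have h4 := (mem_distinctTriples.1 h2).1
        simp only [coe_sigma, Set.mem_sigma_iff, mem_coe, mem_product, mem_filter]
        exact ⟨⟨h1, h4.2.1⟩, h4.2.2, a, h2, h3.symm⟩
      · rintro ⟨t, s⟩ hp ⟨t', s'⟩ hp' heq
        obtain ⟨⟨h1, h2⟩, h3⟩ := mem_similarPairs.1 hp
        obtain ⟨⟨h1', h2'⟩, h3'⟩ := mem_similarPairs.1 hp'
        simp only [Sigma.mk.injEq, Prod.mk.injEq, heq_eq_eq] at heq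
        obtain ⟨⟨rfl, h4⟩, h5⟩ := heq
        have := first_eq_of_simpleRatio h2 h2' (h3.symm.trans h3') h4 h5
        exact Prod.ext rfl this
    have h2 : (#(similarPairs T T) : ℝ) ≤ ∑ i ∈ T ×ˢ A, (#{x ∈ A | rel i x} : ℝ) := by
      exact_mod_cast h1
    linarith
  obtain ⟨X, hXA, hXcard, hdeg, hpath⟩ :=
    exists_subset_popular_paths (T ×ˢ A) A rel hI (by positivity) hτ hA hsum
  refine ⟨X, hXA, hXcard, fun x hx => (hdeg x hx).trans ?_, ?_⟩
  · have h1 : #{i ∈ T ×ˢ A | rel i x} ≤ #{p ∈ similarPairs T T | p.2.2.2 = x} := by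
      refine Finset.card_le_card_of_surjOn (fun p => (p.1, p.2.2.1)) ?_
      rintro ⟨t, v⟩ hi
      obtain ⟨h1, a, h2, h3⟩ := mem_filter.1 hi
      refine ⟨(t, a, v, x), ?_, rfl⟩
      rw [mem_coe, mem_filter, mem_similarPairs]
      exact ⟨⟨⟨(mem_product.1 h1).1, h2⟩, h3.symm⟩, rfl⟩
    exact_mod_cast h1
  · set E : Finset ((F × F × F) × F × F) := T ×ˢ A ×ˢ A with hE
    -- If $x$ and $z$ are both related to $(t,v)$, then $(1-r)a+rx=v=(1-r)a'+rz$, so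
    -- $x-z=\frac{1-r}{r}(a'-a)$. Common indices thus give representations of $x-z$ by triples
    -- $(t,a,a')$.
    set δ : (F × F × F) × F × F → F := fun e =>
      (1 - simpleRatio e.1) / simpleRatio e.1 * (e.2.2 - e.2.1) with hδ
    have hEcard : (#E : ℝ) ≤ (#A : ℝ) ^ 5 := by
      rw [hE, card_product, card_product]
      push_cast
      calc (#T : ℝ) * (#A * #A) ≤ (#A : ℝ) ^ 3 * (#A * #A) := by gcongr
        _ = _ := by ring
    have hrep : ∀ x z, #{i ∈ T ×ˢ A | rel i x ∧ rel i z} ≤ #{e ∈ E | δ e = x - z} := by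
      intro x z
      refine Finset.card_le_card_of_surjOn
        (fun e => (e.1, (1 - simpleRatio e.1) * e.2.1 + simpleRatio e.1 * x)) ?_
      rintro ⟨t, v⟩ hi
      obtain ⟨h1, ⟨a, h2, h3⟩, a', h2', h3'⟩ := mem_filter.1 hi
      have ht := (mem_product.1 h1).1
      have e1 := middle_eq_of_simpleRatio h2 h3
      have e2 := middle_eq_of_simpleRatio h2' h3'
      have hr := simpleRatio_ne_zero ht
      refine ⟨(t, a, a'), ?_, ?_⟩
      · rw [mem_coe, mem_filter, hE, mem_product, mem_product]
        refine ⟨⟨ht, (mem_distinctTriples.1 h2).1.1, (mem_distinctTriples.1 h2').1.1⟩, ?_⟩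
        simp only [hδ] at e1 e2 hr ⊢
        field_simp
        linear_combination e1 - e2
      · exact Prod.ext rfl e1.symm
    have h1 := card_sub_mul_le_sq_card (p := τ / 6 * #A) (k := τ ^ 2 / 128 * (#A : ℝ) ^ 4)
      X A E δ (by positivity) fun x hx y hy => (hpath x hx y hy).trans ?_
    · exact h1.trans (by gcongr)
    · have : {z ∈ A | τ ^ 2 / 128 * (#A : ℝ) ^ 4 ≤ #{i ∈ T ×ˢ A | rel i x ∧ rel i z} ∧
          τ ^ 2 / 128 * (#A : ℝ) ^ 4 ≤ #{i ∈ T ×ˢ A | rel i z ∧ rel i y}} ⊆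
          {z ∈ A | τ ^ 2 / 128 * (#A : ℝ) ^ 4 ≤ #{e ∈ E | δ e = x - z} ∧
          τ ^ 2 / 128 * (#A : ℝ) ^ 4 ≤ #{e ∈ E | δ e = z - y}} := by
        intro z hz
        rw [mem_filter] at hz ⊢
        refine ⟨hz.1, hz.2.1.trans ?_, hz.2.2.trans ?_⟩ <;> exact_mod_cast hrep _ _
      exact_mod_cast card_le_card this

/-- Second selection: a large subset of `A` inside an affine image of `X`, all of whose elements
occur often as the middle entry of a triple ending in `X` similar to another one. -/
theorem exists_subset_affine_image {X : Finset F} {τ : ℝ} (hτ : 0 < τ) (hXA : X ⊆ A)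
    (hX : X.Nonempty)
    (h : ∀ x ∈ X, τ / 2 * (#A : ℝ) ^ 4 ≤
        #{p ∈ similarPairs (distinctTriples A) (distinctTriples A) | p.2.2.2 = x}) :
    ∃ Y ⊆ A, ∃ r c : F, r ≠ 0 ∧ (∀ y ∈ Y, ∃ x ∈ X, y = c + r * x) ∧ τ / 4 * #X ≤ #Y ∧
      ∀ y ∈ Y, τ / 4 * (#A : ℝ) ^ 3 * #X ≤
        #{p ∈ similarPairs (distinctTriples A) (distinctTriples A) |
          p.2.2.1 = y ∧ p.2.2.2 ∈ X} := by
  classical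
  set T := distinctTriples A with hT
  have hn : (0 : ℝ) < #A := by exact_mod_cast (hX.mono hXA).card_pos
  have hx : (0 : ℝ) < #X := by exact_mod_cast hX.card_pos
  have hTcard : (#T : ℝ) ≤ (#A : ℝ) ^ 3 := by exact_mod_cast card_distinctTriples_le A
  set Γ := {p ∈ similarPairs T T | p.2.2.2 ∈ X} with hΓ
  set mass : F → ℝ := fun y => #{p ∈ similarPairs T T | p.2.2.1 = y ∧ p.2.2.2 ∈ X} with hmass
  set Z : Finset F := {y ∈ A | τ / 4 * (#A : ℝ) ^ 3 * #X ≤ mass y} with hZ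
  have hΓcard : τ / 2 * (#A : ℝ) ^ 4 * #X ≤ #Γ := by
    have h1 : #Γ = ∑ x ∈ X, #{p ∈ Γ | p.2.2.2 = x} :=
      card_eq_sum_card_fiberwise fun p hp => (mem_filter.1 hp).2
    have h2 : ∑ x ∈ X, τ / 2 * (#A : ℝ) ^ 4 ≤ ∑ x ∈ X, (#{p ∈ Γ | p.2.2.2 = x} : ℝ) := by
      refine Finset.sum_le_sum fun x hx => (h x hx).trans ?_
      have : {p ∈ similarPairs T T | p.2.2.2 = x} ⊆ {p ∈ Γ | p.2.2.2 = x} := by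
        intro p hp
        rw [mem_filter] at hp
        rw [mem_filter, hΓ, mem_filter]
        exact ⟨⟨hp.1, hp.2 ▸ hx⟩, hp.2⟩
      exact_mod_cast card_le_card this
    rw [sum_const, nsmul_eq_mul] at h2
    have h3 : (#Γ : ℝ) = ∑ x ∈ X, (#{p ∈ Γ | p.2.2.2 = x} : ℝ) := by exact_mod_cast h1
    linarith
  have hsum : (#Γ : ℝ) = ∑ y ∈ A, mass y := by
    have h1 : #Γ = ∑ y ∈ A, #{p ∈ Γ | p.2.2.1 = y} :=
      card_eq_sum_card_fiberwise fun p hp => by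
        have := (mem_similarPairs.1 (mem_filter.1 hp).1).1.2
        exact (mem_distinctTriples.1 this).1.2.1
    rw [h1]
    push_cast
    refine Finset.sum_congr rfl fun y _ => ?_
    simp only [hmass, hΓ, filter_filter, and_comm]
  have hZsum : τ / 4 * (#A : ℝ) ^ 3 * #X * #A ≤ ∑ y ∈ Z, mass y := by
    refine sum_filter_ge_of_sum_ge A mass le_rfl (by positivity) ?_
    rw [← hsum]
    linarith
  set Γ' := {p ∈ Γ | p.2.2.1 ∈ Z} with hΓ'
  have hΓ'card : τ / 4 * #X * (#A : ℝ) ^ 4 ≤ #Γ' := by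
    have h1 : #Γ' = ∑ y ∈ Z, #{p ∈ Γ' | p.2.2.1 = y} :=
      card_eq_sum_card_fiberwise fun p hp => (mem_filter.1 hp).2
    have h2 : (#Γ' : ℝ) = ∑ y ∈ Z, mass y := by
      rw [h1]
      push_cast
      refine Finset.sum_congr rfl fun y hy => ?_
      simp only [hmass]
      congr 2
      ext p
      simp only [hΓ', hΓ, mem_filter]
      constructor
      · tauto
      · rintro ⟨h1, rfl, h2⟩
        exact ⟨⟨⟨h1, h2⟩, hy⟩, rfl⟩
    linarith
  have hΓ'ne : Γ'.Nonempty := by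
    rw [← card_pos]
    have : 0 < τ / 4 * #X * (#A : ℝ) ^ 4 := by positivity
    exact_mod_cast this.trans_le hΓ'card
  have hI : (#(T ×ˢ A) : ℝ) ≤ (#A : ℝ) ^ 4 := by
    rw [card_product]
    push_cast
    calc (#T : ℝ) * #A ≤ (#A : ℝ) ^ 3 * #A := by gcongr
      _ = _ := by ring
  -- Fixing the ratio and the first entry $a$ of the second triple turns $y=(1-r)a+rx$ into an
  -- affine function of $x$.
  obtain ⟨⟨t, a⟩, hta, hfib⟩ := exists_large_fiber Γ' hΓ'ne (T ×ˢ A) (fun p => (p.1, p.2.1))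
    (fun p hp => by
      have := (mem_similarPairs.1 (mem_filter.1 (mem_filter.1 hp).1).1).1
      exact mem_product.2 ⟨this.1, (mem_distinctTriples.1 this.2).1.1⟩) hI (by positivity) hΓ'card
  have ht := (mem_product.1 hta).1
  refine ⟨{p ∈ Γ' | (p.1, p.2.1) = (t, a)}.image (fun p => p.2.2.1), ?_, simpleRatio t,
    (1 - simpleRatio t) * a, simpleRatio_ne_zero ht, ?_, ?_, ?_⟩
  · intro y hy
    obtain ⟨p, hp, rfl⟩ := mem_image.1 hy
    exact (mem_filter.1 (mem_filter.1 (mem_filter.1 hp).1).2).1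
  · intro y hy
    obtain ⟨⟨t', s⟩, hp, rfl⟩ := mem_image.1 hy
    obtain ⟨hp1, hp2⟩ := mem_filter.1 hp
    simp only [Prod.mk.injEq] at hp2
    obtain ⟨rfl, rfl⟩ := hp2
    have h1 := (mem_filter.1 hp1).1
    have h2 := mem_similarPairs.1 (mem_filter.1 h1).1
    exact ⟨s.2.2, (mem_filter.1 h1).2, middle_eq_of_simpleRatio h2.1.2 h2.2.symm⟩
  · rw [card_image_of_injOn]
    · exact hfib
    · rintro ⟨t', s⟩ hp ⟨t'', s'⟩ hp' heq
      obtain ⟨hp1, hp2⟩ := mem_filter.1 hp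
      obtain ⟨hp1', hp2'⟩ := mem_filter.1 hp'
      simp only [Prod.mk.injEq] at hp2 hp2'
      obtain ⟨rfl, rfl⟩ := hp2
      obtain ⟨rfl, h3⟩ := hp2'
      have h2 := mem_similarPairs.1 (mem_filter.1 (mem_filter.1 hp1).1).1
      have h2' := mem_similarPairs.1 (mem_filter.1 (mem_filter.1 hp1').1).1
      have := third_eq_of_simpleRatio h2.1.2 h2'.1.2 (h2.2.symm.trans h2'.2) h3.symm heq
      simp only at this
      rw [this]
  · intro y hy
    obtain ⟨p, hp, rfl⟩ := mem_image.1 hy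
    exact (mem_filter.1 (mem_filter.1 (mem_filter.1 hp).1).2).2

/-- Third selection: many elements `x` of `X` for which `l (x - b)` nearly preserves `X`. -/
theorem exists_subset_nearlyPreserves {X Y : Finset F} {τ : ℝ} {r₀ c : F} (hτ : 0 < τ)
    (hXA : X ⊆ A) (hX : X.Nonempty) (hY : Y.Nonempty) (hr₀ : r₀ ≠ 0)
    (hYX : ∀ y ∈ Y, ∃ x ∈ X, y = c + r₀ * x)
    (hcoll : (#(similarPairs (distinctTriples A) (distinctTriples A)) : ℝ) ≤ τ * (#A : ℝ) ^ 5)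
    (h : ∀ y ∈ Y, τ / 4 * (#A : ℝ) ^ 3 * #X ≤
        #{p ∈ similarPairs (distinctTriples A) (distinctTriples A) |
          p.2.2.1 = y ∧ p.2.2.2 ∈ X}) :
    ∃ S ⊆ X, ∃ b l : F, l ≠ 0 ∧ τ / 32 * #X ≤ #S ∧
      ∀ x ∈ S, NearlyPreserves X (τ / 32 * (#X * #Y) / #A) (l * (x - b)) := by
  classical
  set T := distinctTriples A with hT
  set Q : Finset (F × F × F) := {t ∈ T | t.2.1 ∈ Y ∧ t.2.2 ∈ X} with hQ
  have hn : (0 : ℝ) < #A := by exact_mod_cast (hX.mono hXA).card_pos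
  have hx : (0 : ℝ) < #X := by exact_mod_cast hX.card_pos
  have hy : (0 : ℝ) < #Y := by exact_mod_cast hY.card_pos
  have hQT : Q ⊆ T := filter_subset _ _
  have hTQ : τ / 4 * (#A : ℝ) ^ 3 * #X * #Y ≤ #(similarPairs T Q) := by
    have h1 : #(similarPairs T Q) = ∑ y ∈ Y, #{p ∈ similarPairs T Q | p.2.2.1 = y} :=
      card_eq_sum_card_fiberwise fun p hp => by
        exact (mem_filter.1 (mem_similarPairs.1 hp).1.2).2.1
    have h2 : ∑ y ∈ Y, τ / 4 * (#A : ℝ) ^ 3 * #X ≤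
        ∑ y ∈ Y, (#{p ∈ similarPairs T Q | p.2.2.1 = y} : ℝ) := by
      refine Finset.sum_le_sum fun y hy => (h y hy).trans ?_
      have : {p ∈ similarPairs T T | p.2.2.1 = y ∧ p.2.2.2 ∈ X} ⊆
          {p ∈ similarPairs T Q | p.2.2.1 = y} := by
        intro p hp
        rw [mem_filter, mem_similarPairs] at hp
        rw [mem_filter, mem_similarPairs, hQ, mem_filter]
        exact ⟨⟨⟨hp.1.1.1, hp.1.1.2, hp.2.1 ▸ hy, hp.2.2⟩, hp.1.2⟩, hp.2.1⟩
      exact_mod_cast card_le_card this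
    rw [sum_const, nsmul_eq_mul] at h2
    have h3 : (#(similarPairs T Q) : ℝ) = ∑ y ∈ Y, (#{p ∈ similarPairs T Q | p.2.2.1 = y} : ℝ) := by
      exact_mod_cast h1
    linarith
  -- Cauchy–Schwarz passes from one triple in $Q$ to both. The upper bound `hcoll` on the total
  -- count cancels one power of $\tau$.
  have hQQ : τ / 16 * (#X : ℝ) ^ 2 * #Y * (#A * #Y) ≤ #(similarPairs Q Q) := by
    have h1 : (#(similarPairs T Q) : ℝ) ^ 2 ≤ #(similarPairs T T) * #(similarPairs Q Q) := by
      exact_mod_cast sq_card_matching_le T Q simpleRatio simpleRatio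
    have h2 : (τ / 4 * (#A : ℝ) ^ 3 * #X * #Y) ^ 2 ≤ (#(similarPairs T Q) : ℝ) ^ 2 := by gcongr
    have h3 : (#(similarPairs T T) : ℝ) * #(similarPairs Q Q) ≤
        τ * (#A : ℝ) ^ 5 * #(similarPairs Q Q) := by gcongr
    refine le_of_mul_le_mul_left (a := τ * (#A : ℝ) ^ 5) ?_ (by positivity)
    calc _ = (τ / 4 * (#A : ℝ) ^ 3 * #X * #Y) ^ 2 := by ring
      _ ≤ _ := h2.trans (h1.trans h3)
  have hne : (similarPairs Q Q).Nonempty := by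
    rw [← card_pos]
    have : 0 < τ / 16 * (#X : ℝ) ^ 2 * #Y * (#A * #Y) := by positivity
    exact_mod_cast this.trans_le hQQ
  obtain ⟨⟨b, y⟩, hby, hfib⟩ := exists_large_fiber (similarPairs Q Q) hne (A ×ˢ Y)
    (fun p => (p.1.1, p.1.2.1)) (fun p hp => by
      have h1 := mem_filter.1 (mem_similarPairs.1 hp).1.1
      exact mem_product.2 ⟨(mem_distinctTriples.1 h1.1).1.1, h1.2.1⟩)
    (m := #A * #Y) (by rw [card_product]; push_cast; exact le_rfl) (by positivity) hQQ
  set P := {p ∈ similarPairs Q Q | (p.1.1, p.1.2.1) = (b, y)} with hP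
  have hPmem : ∀ p ∈ P, p.1 ∈ Q ∧ p.2 ∈ Q ∧ simpleRatio p.1 = simpleRatio p.2 ∧ p.1.1 = b ∧
      p.1.2.1 = y := by
    intro p hp
    rw [hP, mem_filter, mem_similarPairs] at hp
    have := Prod.ext_iff.1 hp.2
    exact ⟨hp.1.1.1, hp.1.1.2, hp.1.2, this.1, this.2⟩
  set f : F → ℝ := fun x => #{p ∈ P | p.1.2.2 = x} with hf
  have hsum : (#P : ℝ) = ∑ x ∈ X, f x := by
    have h1 : #P = ∑ x ∈ X, #{p ∈ P | p.1.2.2 = x} :=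
      card_eq_sum_card_fiberwise fun p hp => (mem_filter.1 (hPmem p hp).1).2.2
    simp only [hf]
    exact_mod_cast h1
  have hfle : ∀ x ∈ X, f x ≤ #X * #Y := by
    intro x _
    have h1 : #{p ∈ P | p.1.2.2 = x} ≤ #(X ×ˢ Y) := by
      refine Finset.card_le_card_of_injOn (fun p => (p.2.2.2, p.2.2.1)) ?_ ?_
      · intro p hp
        have := (mem_filter.1 (hPmem p (mem_filter.1 hp).1).2.1).2
        exact mem_product.2 ⟨this.2, this.1⟩
      · rintro ⟨t, s⟩ hp ⟨t', s'⟩ hp' heq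
        obtain ⟨hp1, hp2⟩ := mem_filter.1 hp
        obtain ⟨hp1', hp2'⟩ := mem_filter.1 hp'
        obtain ⟨-, h2, h3, h4, h5⟩ := hPmem _ hp1
        obtain ⟨-, h2', h3', h4', h5'⟩ := hPmem _ hp1'
        have ht : t = t' :=
          Prod.ext (h4.trans h4'.symm) (Prod.ext (h5.trans h5'.symm) (hp2.trans hp2'.symm))
        subst ht
        have heq := Prod.ext_iff.1 heq
        have := first_eq_of_simpleRatio (hQT h2) (hQT h2') (h3.symm.trans h3') heq.2 heq.1
        simp only at this
        rw [this]
    rw [card_product] at h1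
    simp only [hf]
    exact_mod_cast h1
  have hw : 0 < τ / 32 * ((#X : ℝ) * #Y) / #A := by positivity
  refine ⟨{x ∈ X | τ / 32 * (#X * #Y) ≤ f x}, filter_subset _ _, b, r₀ / (y - b), ?_, ?_, ?_⟩
  · have hPne : P.Nonempty := by
      rw [← card_pos]
      have : 0 < τ / 16 * (#X : ℝ) ^ 2 * #Y := by positivity
      exact_mod_cast this.trans_le hfib
    obtain ⟨p, hp⟩ := hPne
    obtain ⟨h1, -, -, h4, h5⟩ := hPmem p hp
    have := (mem_distinctTriples.1 (hQT h1)).2.1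
    rw [h4, h5] at this
    exact div_ne_zero hr₀ (sub_ne_zero.2 this.symm)
  · refine mul_card_le_card_filter X f (by positivity) (by positivity) hfle ?_
    rw [← hsum]
    refine le_trans (le_of_eq ?_) hfib
    ring
  · intro x hxS
    obtain ⟨hxX, hfx⟩ := mem_filter.1 hxS
    set R := {p ∈ P | p.1.2.2 = x} with hR
    have hRcard : τ / 32 * (#X * #Y) / #A * #A ≤ #R := by
      rw [div_mul_cancel₀ _ hn.ne']
      exact hfx
    have hRne : R.Nonempty := by
      rw [← card_pos]
      exact_mod_cast (mul_pos hw hn).trans_le hRcard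
    obtain ⟨a, ha, hRa⟩ := exists_large_fiber R hRne A (fun p => p.2.1) (fun p hp => by
      have := (hPmem p (mem_filter.1 hp).1).2.1
      exact (mem_distinctTriples.1 (hQT this)).1.1) le_rfl hw.le hRcard
    obtain ⟨p₀, hp₀⟩ := hRne
    obtain ⟨hp₀1, hp₀2⟩ := mem_filter.1 hp₀
    obtain ⟨hQ₀, -, -, hb, hy⟩ := hPmem p₀ hp₀1
    set r := simpleRatio p₀.1 with hr
    have hrne : r ≠ 0 := simpleRatio_ne_zero (hQT hQ₀)
    have hreq : r = (y - b) / (x - b) := by rw [hr, simpleRatio, hb, hy, hp₀2]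
    have hs : r₀ / (y - b) * (x - b) = r₀ / r := by
      rw [hreq, div_div_eq_mul_div, div_mul_eq_mul_div]
    have hR2 : ∀ p ∈ R, p.2 ∈ Q ∧ simpleRatio p.2 = r ∧ p.1 = p₀.1 := by
      intro p hp
      obtain ⟨hp1, hp2⟩ := mem_filter.1 hp
      obtain ⟨h1, h2, h3, h4, h5⟩ := hPmem p hp1
      have : p.1 = p₀.1 :=
        Prod.ext (h4.trans hb.symm) (Prod.ext (h5.trans hy.symm) (hp2.trans hp₀2.symm))
      exact ⟨h2, by rw [← h3, this], this⟩
    -- Writing the middle entry as $c+r_0z$ with $z\in X$, the relation $c+r_0z=(1-r)a+rx'$ says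
    -- that $x'=(r_0/r)z+(c-(1-r)a)/r$, and $r_0/r=l(x-b)$.
    refine ⟨(c - (1 - r) * a) / r, hRa.trans ?_⟩
    have h1 : #{p ∈ R | p.2.1 = a} ≤
        #{z ∈ X | r₀ / (y - b) * (x - b) * z + (c - (1 - r) * a) / r ∈ X} := by
      refine Finset.card_le_card_of_injOn (fun p => (p.2.2.1 - c) / r₀) ?_ ?_
      · intro p hp
        obtain ⟨hp1, hp2⟩ := mem_filter.1 hp
        obtain ⟨h1, h2, -⟩ := hR2 p hp1
        obtain ⟨h3, h4, h5⟩ := mem_filter.1 h1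
        have h6 := middle_eq_of_simpleRatio h3 h2
        obtain ⟨z, hz, hz'⟩ := hYX _ h4
        have hz2 : (p.2.2.1 - c) / r₀ = z := by rw [hz']; field_simp; ring
        rw [mem_coe, mem_filter]
        simp only [hz2]
        refine ⟨hz, ?_⟩
        convert h5 using 1
        rw [hs]
        rw [hz', hp2] at h6
        field_simp
        linear_combination h6
      · intro p hp p' hp' heq
        obtain ⟨hp1, hp2⟩ := mem_filter.1 hp
        obtain ⟨hp1', hp2'⟩ := mem_filter.1 hp'
        obtain ⟨h1, h2, h3⟩ := hR2 p hp1
        obtain ⟨h1', h2', h3'⟩ := hR2 p' hp1'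
        have heq2 : p.2.2.1 = p'.2.2.1 := by
          simp only at heq
          exact sub_left_injective ((div_left_inj' hr₀).1 heq)
        exact Prod.ext (h3.trans h3'.symm)
          (third_eq_of_simpleRatio (hQT h1) (hQT h1') (h2.trans h2'.symm) (hp2.trans hp2'.symm) heq2)
    exact_mod_cast h1

end Triples

/-! ### The bound on collinear triples -/

section CollinearTriples

variable {F : Type*} [Field F] [DecidableEq F] {A : Finset F}

/-- A coincidence among the entries on one side makes a product of differences vanish. This leaves
five degenerate families with four free parameters: all three $a$'s equal, all three $b$'s equal, or
two of the three points equal. -/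
theorem collinearTriples_le (A : Finset F) :
    collinearTriples A A ≤
      #(similarPairs (distinctTriples A) (distinctTriples A)) + 5 * #A ^ 4 := by
  set Q := A ×ˢ A ×ˢ A ×ˢ A with hQ
  have hQcard : #Q = #A ^ 4 := by
    rw [hQ, card_product, card_product, card_product]; ring
  set f₁ : F × F × F × F → (F × F × F) × (F × F × F) :=
    fun z => ((z.1, z.1, z.1), (z.2.1, z.2.2.1, z.2.2.2))
  set f₂ : F × F × F × F → (F × F × F) × (F × F × F) :=
    fun z => ((z.2.1, z.2.2.1, z.2.2.2), (z.1, z.1, z.1))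
  set f₃ : F × F × F × F → (F × F × F) × (F × F × F) :=
    fun z => ((z.1, z.1, z.2.1), (z.2.2.1, z.2.2.1, z.2.2.2))
  set f₄ : F × F × F × F → (F × F × F) × (F × F × F) :=
    fun z => ((z.1, z.2.1, z.1), (z.2.2.1, z.2.2.2, z.2.2.1))
  set f₅ : F × F × F × F → (F × F × F) × (F × F × F) :=
    fun z => ((z.1, z.2.1, z.2.1), (z.2.2.1, z.2.2.2, z.2.2.2))
  set U := similarPairs (distinctTriples A) (distinctTriples A) ∪
    (Q.image f₁ ∪ (Q.image f₂ ∪ (Q.image f₃ ∪ (Q.image f₄ ∪ Q.image f₅)))) with hU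
  have hsub : {t : (F × F × F) × (F × F × F) |
      (t.1.1 ∈ A ∧ t.1.2.1 ∈ A ∧ t.1.2.2 ∈ A) ∧ (t.2.1 ∈ A ∧ t.2.2.1 ∈ A ∧ t.2.2.2 ∈ A) ∧
      (t.1.2.1 - t.1.1) * (t.2.2.2 - t.2.1) = (t.1.2.2 - t.1.1) * (t.2.2.1 - t.2.1)} ⊆ U := by
    rintro ⟨⟨a₁, a₂, a₃⟩, b₁, b₂, b₃⟩ ⟨⟨ha₁, ha₂, ha₃⟩, ⟨hb₁, hb₂, hb₃⟩, h⟩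
    simp only at ha₁ ha₂ ha₃ hb₁ hb₂ hb₃ h
    have hmem : ∀ (f : F × F × F × F → (F × F × F) × (F × F × F)) (x y z w : F),
        x ∈ A → y ∈ A → z ∈ A → w ∈ A → f (x, y, z, w) ∈ Q.image f :=
      fun f x y z w hx hy hz hw => mem_image_of_mem f (by simp [hQ, hx, hy, hz, hw])
    have m₁ := hmem f₁
    have m₂ := hmem f₂
    have m₃ := hmem f₃
    have m₄ := hmem f₄
    have m₅ := hmem f₅
    simp only [hU, coe_union, Set.mem_union, mem_coe]
    by_cases hA : a₁ = a₂ ∧ a₁ = a₃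
    · obtain ⟨rfl, rfl⟩ := hA
      exact Or.inr (Or.inl (m₁ a₁ b₁ b₂ b₃ ha₁ hb₁ hb₂ hb₃))
    by_cases hB : b₁ = b₂ ∧ b₁ = b₃
    · obtain ⟨rfl, rfl⟩ := hB
      exact Or.inr (Or.inr (Or.inl (m₂ b₁ a₁ a₂ a₃ hb₁ ha₁ ha₂ ha₃)))
    by_cases h12 : a₁ = a₂ ∧ b₁ = b₂
    · obtain ⟨rfl, rfl⟩ := h12
      exact Or.inr (Or.inr (Or.inr (Or.inl (m₃ a₁ a₃ b₁ b₃ ha₁ ha₃ hb₁ hb₃))))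
    by_cases h13 : a₁ = a₃ ∧ b₁ = b₃
    · obtain ⟨rfl, rfl⟩ := h13
      exact Or.inr (Or.inr (Or.inr (Or.inr (Or.inl (m₄ a₁ a₂ b₁ b₂ ha₁ ha₂ hb₁ hb₂)))))
    by_cases h23 : a₂ = a₃ ∧ b₂ = b₃
    · obtain ⟨rfl, rfl⟩ := h23
      exact Or.inr (Or.inr (Or.inr (Or.inr (Or.inr (m₅ a₁ a₂ b₁ b₂ ha₁ ha₂ hb₁ hb₂)))))
    left
    have key : ∀ {x y : F}, x * y = 0 → x = 0 ∨ y = 0 := fun h => mul_eq_zero.1 h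
    have e12 : a₁ ≠ a₂ := by
      rintro rfl
      rcases key (x := a₃ - a₁) (y := b₂ - b₁) (by linear_combination -h) with h' | h'
      · exact hA ⟨rfl, (sub_eq_zero.1 h').symm⟩
      · exact h12 ⟨rfl, (sub_eq_zero.1 h').symm⟩
    have e13 : a₁ ≠ a₃ := by
      rintro rfl
      rcases key (x := a₂ - a₁) (y := b₃ - b₁) (by linear_combination h) with h' | h'
      · exact hA ⟨(sub_eq_zero.1 h').symm, rfl⟩
      · exact h13 ⟨rfl, (sub_eq_zero.1 h').symm⟩
    have e23 : a₂ ≠ a₃ := by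
      rintro rfl
      rcases key (x := a₂ - a₁) (y := b₃ - b₂) (by linear_combination h) with h' | h'
      · exact e12 (sub_eq_zero.1 h').symm
      · exact h23 ⟨rfl, (sub_eq_zero.1 h').symm⟩
    have f12 : b₁ ≠ b₂ := by
      rintro rfl
      rcases key (x := a₂ - a₁) (y := b₃ - b₁) (by linear_combination h) with h' | h'
      · exact e12 (sub_eq_zero.1 h').symm
      · exact hB ⟨rfl, (sub_eq_zero.1 h').symm⟩
    have f13 : b₁ ≠ b₃ := by
      rintro rfl
      rcases key (x := a₃ - a₁) (y := b₂ - b₁) (by linear_combination -h) with h' | h'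
      · exact e13 (sub_eq_zero.1 h').symm
      · exact hB ⟨(sub_eq_zero.1 h').symm, rfl⟩
    have f23 : b₂ ≠ b₃ := by
      rintro rfl
      rcases key (x := a₂ - a₃) (y := b₂ - b₁) (by linear_combination h) with h' | h'
      · exact e23 (sub_eq_zero.1 h')
      · exact f12 (sub_eq_zero.1 h').symm
    refine mem_similarPairs.2 ⟨⟨mem_distinctTriples.2 ⟨⟨ha₁, ha₂, ha₃⟩, e12, e13, e23⟩,
      mem_distinctTriples.2 ⟨⟨hb₁, hb₂, hb₃⟩, f12, f13, f23⟩⟩, ?_⟩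
    simp only [simpleRatio]
    rw [div_eq_div_iff (sub_ne_zero.2 e13.symm) (sub_ne_zero.2 f13.symm)]
    linear_combination h
  have h1 : collinearTriples A A ≤ #U := by
    rw [← Set.ncard_coe_finset]
    exact Set.ncard_le_ncard hsub (Finset.finite_toSet U)
  have h2 : ∀ f : F × F × F × F → (F × F × F) × (F × F × F), #(Q.image f) ≤ #A ^ 4 :=
    fun f => card_image_le.trans hQcard.le
  have h3 := h2 f₁
  have h4 := h2 f₂
  have h5 := h2 f₃
  have h6 := h2 f₄
  have h7 := h2 f₅
  have u1 := card_union_le (similarPairs (distinctTriples A) (distinctTriples A))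
    (Q.image f₁ ∪ (Q.image f₂ ∪ (Q.image f₃ ∪ (Q.image f₄ ∪ Q.image f₅))))
  have u2 := card_union_le (Q.image f₁) (Q.image f₂ ∪ (Q.image f₃ ∪ (Q.image f₄ ∪ Q.image f₅)))
  have u3 := card_union_le (Q.image f₂) (Q.image f₃ ∪ (Q.image f₄ ∪ Q.image f₅))
  have u4 := card_union_le (Q.image f₃) (Q.image f₄ ∪ Q.image f₅)
  have u5 := card_union_le (Q.image f₄) (Q.image f₅)
  rw [← hU] at u1
  omega

theorem card_three_nsmul_sub_le {X : Finset F} (hX : X.Nonempty) :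
    (#(3 • X - 3 • X) : ℝ) ≤ (#(X - X) / #X : ℝ) ^ 6 * #X := by
  have h := pluennecke_ruzsa_inequality_nsmul_sub_nsmul_sub hX X 3 3
  have h2 : ((#(3 • X - 3 • X) : ℚ≥0) : ℝ) ≤ (((#(X - X) / #X : ℚ≥0) ^ (3 + 3) * #X : ℚ≥0) : ℝ) := by
    exact_mod_cast h
  push_cast at h2
  exact h2

/-- With $w\gg\tau^3x$ and $s\gg\tau x$, the pivot bound becomes
$\tau^{20}x^{13}\ll(1+s^2/g)\,d^{12}$. Inserting $x\gg\tau n$ and $d\ll\tau^{-5}n$ gives the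
exponent $93=20+13+60$. -/
theorem pivot_numerics {n x y d s w z g τ : ℝ} (hn : 0 < n) (hτ : 0 < τ) (hg : 0 < g)
    (hd : 0 < d) (hx : τ / 4 * n ≤ x) (hy : τ / 4 * x ≤ y) (hs : τ / 32 * x ≤ s)
    (hD : d * (τ / 6 * n * (τ ^ 2 / 128 * n ^ 4) ^ 2) ≤ (n ^ 5) ^ 2)
    (hw : w = τ / 32 * (x * y) / n) (hz : z ≤ (d / x) ^ 6 * x)
    (h : (w / d) ^ 6 * s ^ 2 * g ≤ (g + s ^ 2) * z) :
    n * τ ^ 93 ≤ 512 ^ 6 * 1024 * 4 ^ 13 * 98304 ^ 12 * (1 + s ^ 2 / g) := by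
  have hx0 : 0 < x := lt_of_lt_of_le (by positivity) hx
  have hw1 : τ ^ 3 / 512 * x ≤ w := by
    rw [hw, le_div_iff₀ hn]
    calc τ ^ 3 / 512 * x * n = τ / 32 * (τ / 4 * n) * (τ / 4 * x) := by ring
      _ ≤ τ / 32 * x * y := by gcongr
      _ = _ := by ring
  have hD1 : d * τ ^ 5 ≤ 98304 * n := by
    have h9 : (0 : ℝ) < n ^ 9 := by positivity
    refine le_of_mul_le_mul_right ?_ h9
    calc d * τ ^ 5 * n ^ 9 = 98304 * (d * (τ / 6 * n * (τ ^ 2 / 128 * n ^ 4) ^ 2)) := by ring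
      _ ≤ 98304 * (n ^ 5) ^ 2 := by gcongr
      _ = _ := by ring
  set B := 1 + s ^ 2 / g with hB
  have hBg : g + s ^ 2 = B * g := by rw [hB]; field_simp
  have hBpos : 0 < B := by positivity
  have hcore : (τ ^ 3 / 512) ^ 6 * (τ / 32) ^ 2 * x ^ 13 ≤ B * d ^ 12 := by
    have h1 : (τ ^ 3 / 512 * x / d) ^ 6 * (τ / 32 * x) ^ 2 * g ≤ B * g * ((d / x) ^ 6 * x) := by
      calc _ ≤ (w / d) ^ 6 * s ^ 2 * g := by gcongr
        _ ≤ (g + s ^ 2) * z := h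
        _ ≤ _ := by rw [hBg]; gcongr
    have h2 : (0 : ℝ) < d ^ 6 * x ^ 5 / g := by positivity
    have h3 := mul_le_mul_of_nonneg_right h1 h2.le
    have e1 : (τ ^ 3 / 512 * x / d) ^ 6 * (τ / 32 * x) ^ 2 * g * (d ^ 6 * x ^ 5 / g) =
        (τ ^ 3 / 512) ^ 6 * (τ / 32) ^ 2 * x ^ 13 := by
      field_simp
    have e2 : B * g * ((d / x) ^ 6 * x) * (d ^ 6 * x ^ 5 / g) = B * d ^ 12 := by
      field_simp
    rwa [e1, e2] at h3
  have h12 : (0 : ℝ) < n ^ 12 := by positivity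
  refine le_of_mul_le_mul_right ?_ h12
  calc n * τ ^ 93 * n ^ 12 = 512 ^ 6 * 1024 * 4 ^ 13 *
        ((τ ^ 3 / 512) ^ 6 * (τ / 32) ^ 2 * (τ / 4 * n) ^ 13) * τ ^ 60 := by ring
    _ ≤ 512 ^ 6 * 1024 * 4 ^ 13 * ((τ ^ 3 / 512) ^ 6 * (τ / 32) ^ 2 * x ^ 13) * τ ^ 60 := by gcongr
    _ ≤ 512 ^ 6 * 1024 * 4 ^ 13 * (B * d ^ 12) * τ ^ 60 := by gcongr
    _ = 512 ^ 6 * 1024 * 4 ^ 13 * B * (d * τ ^ 5) ^ 12 := by ring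
    _ ≤ 512 ^ 6 * 1024 * 4 ^ 13 * B * (98304 * n) ^ 12 := by gcongr
    _ = _ := by ring

/-- If `A` has `τ |A|⁵` pairs of similar triples, then a proportion `τ²` of `A` lies in an affine
image of a subfield, and `|A|` is bounded in terms of `τ` unless the subfield is small. -/
theorem exists_subset_subfield_bound [Finite F] {τ : ℝ} (hτ : 0 < τ) (hA : A.Nonempty)
    (h : (#(similarPairs (distinctTriples A) (distinctTriples A)) : ℝ) = τ * (#A : ℝ) ^ 5) :
    ∃ S ⊆ A, ∃ G : Subfield F, ∃ b l : F, l ≠ 0 ∧ (∀ x ∈ S, l * (x - b) ∈ G) ∧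
      τ ^ 2 / 128 * #A ≤ #S ∧
      #A * τ ^ 93 ≤ 512 ^ 6 * 1024 * 4 ^ 13 * 98304 ^ 12 * (1 + (#S : ℝ) ^ 2 / Nat.card G) := by
  have hn : (0 : ℝ) < #A := by exact_mod_cast hA.card_pos
  obtain ⟨X, hXA, hX, hmass, hD⟩ := exists_subset_few_differences hτ hA h.ge
  have hx : (0 : ℝ) < #X := lt_of_lt_of_le (by positivity) hX
  have hXne : X.Nonempty := by rw [← card_pos]; exact_mod_cast hx
  obtain ⟨Y, hYA, r₀, c, hr₀, hYX, hY, hmassY⟩ := exists_subset_affine_image hτ hXA hXne hmass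
  have hy : (0 : ℝ) < #Y := lt_of_lt_of_le (by positivity) hY
  have hYne : Y.Nonempty := by rw [← card_pos]; exact_mod_cast hy
  obtain ⟨S, hSX, b, l, hl, hS, hgood⟩ :=
    exists_subset_nearlyPreserves hτ hXA hXne hYne hr₀ hYX h.le hmassY
  have hs : (0 : ℝ) < #S := lt_of_lt_of_le (by positivity) hS
  have hSne : S.Nonempty := by rw [← card_pos]; exact_mod_cast hs
  obtain ⟨G, hG, hbound⟩ := pivot_bound (by positivity) hSX hSne hl hgood
  refine ⟨S, hSX.trans hXA, G, b, l, hl, hG, ?_, ?_⟩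
  · calc τ ^ 2 / 128 * #A = τ / 32 * (τ / 4 * #A) := by ring
      _ ≤ τ / 32 * #X := by gcongr
      _ ≤ _ := hS
  · refine pivot_numerics hn hτ (by exact_mod_cast Nat.card_pos) ?_ hX hY hS hD rfl
      (card_three_nsmul_sub_le hXne) hbound
    exact_mod_cast (hXne.sub hXne).card_pos

/-- The whole field gives the term $|A|^2/q$. For a proper subfield the two terms in the
non-concentration maximum give the first alternative and the bound $|S|^2\le C^2|G|$. -/
theorem similarPairs_bound [Fintype F] {C τ : ℝ} (hC : 0 < C) (hτ : 0 < τ) (hA : A.Nonempty)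
    (hAC : AvoidsSubfields C A)
    (h : (#(similarPairs (distinctTriples A) (distinctTriples A)) : ℝ) = τ * (#A : ℝ) ^ 5) :
    τ ^ 2 / 128 * #A ≤ C * (#A : ℝ) ^ (51 / 52 : ℝ) ∨
      #A * τ ^ 93 ≤ 512 ^ 6 * 1024 * 4 ^ 13 * 98304 ^ 12 *
        (1 + C ^ 2 + (#A : ℝ) ^ 2 / Fintype.card F) := by
  obtain ⟨S, hSA, G, b, l, hl, hG, hS, hbound⟩ := exists_subset_subfield_bound hτ hA h
  by_cases htop : G = ⊤
  · right
    have hcard : Nat.card G = Fintype.card F := by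
      rw [htop, ← Nat.card_eq_fintype_card]
      exact Nat.card_congr (Equiv.subtypeUnivEquiv fun _ => Subfield.mem_top _)
    rw [hcard] at hbound
    have h1 : (#S : ℝ) ≤ #A := by exact_mod_cast card_le_card hSA
    calc _ ≤ _ := hbound
      _ ≤ 512 ^ 6 * 1024 * 4 ^ 13 * 98304 ^ 12 *
        (1 + 0 + (#A : ℝ) ^ 2 / Fintype.card F) := by rw [add_zero]; gcongr
      _ ≤ _ := by gcongr; positivity
  · have h1 := hAC G htop l⁻¹ b
    have h2 : (#S : ℝ) ≤ (Set.ncard ((A : Set F) ∩ subfieldAffineImage G l⁻¹ b) : ℝ) := by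
      rw [← Set.ncard_coe_finset]
      refine Nat.cast_le.2 (Set.ncard_le_ncard ?_ ((Finset.finite_toSet A).inter_of_left _))
      intro x hx
      refine ⟨hSA hx, l * (x - b), hG x hx, ?_⟩
      rw [inv_mul_cancel_left₀ hl, sub_add_cancel]
    have h3 := h2.trans h1
    rcases le_total ((Nat.card G : ℝ) ^ (1 / 2 : ℝ)) ((#A : ℝ) ^ (51 / 52 : ℝ)) with h4 | h4
    · left
      rw [max_eq_right h4] at h3
      exact hS.trans h3
    · right
      rw [max_eq_left h4] at h3
      have hGpos : (0 : ℝ) < Nat.card G := by exact_mod_cast Nat.card_pos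
      have h5 : (#S : ℝ) ^ 2 ≤ C ^ 2 * Nat.card G := by
        calc (#S : ℝ) ^ 2 ≤ (C * (Nat.card G : ℝ) ^ (1 / 2 : ℝ)) ^ 2 := by gcongr
          _ = C ^ 2 * ((Nat.card G : ℝ) ^ (1 / 2 : ℝ)) ^ 2 := by ring
          _ = _ := by rw [← Real.sqrt_eq_rpow, Real.sq_sqrt hGpos.le]
      have h6 : (#S : ℝ) ^ 2 / Nat.card G ≤ C ^ 2 := (div_le_iff₀ hGpos).2 h5
      calc _ ≤ _ := hbound
        _ ≤ 512 ^ 6 * 1024 * 4 ^ 13 * 98304 ^ 12 * (1 + C ^ 2 + 0) := by rw [add_zero]; gcongr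
        _ ≤ _ := by gcongr; positivity

theorem le_mul_of_pow_le_mul_pow {τ x M : ℝ} {k m : ℕ} (hk : k ≠ 0) (hkm : k ≤ m) (hx : 0 ≤ x)
    (hx1 : x ≤ 1) (hM : 1 ≤ M) (h : τ ^ k ≤ M * x ^ m) : τ ≤ M * x := by
  refine le_of_pow_le_pow_left₀ hk (by positivity) (h.trans ?_)
  rw [mul_pow]
  have h1 : x ^ m ≤ x ^ k := pow_le_pow_of_le_one hx hx1 hkm
  have h2 : M ≤ M ^ k := le_self_pow₀ hM hk
  gcongr

theorem collinearTriples_bound (C : ℝ) (hC : 0 < C) :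
    ∃ K : ℝ, 1 ≤ K ∧ ∀ (F : Type*) [Field F] [Fintype F] (A : Finset F), A.Nonempty →
      AvoidsSubfields C A → (collinearTriples A A : ℝ) ≤
        K * ((#A : ℝ) ^ (5 - 1 / 104 : ℝ) +
          (Fintype.card F : ℝ) ^ (-(1 / 95) : ℝ) * (#A : ℝ) ^ (5 + 1 / 95 : ℝ)) := by
  obtain ⟨c, hc⟩ : ∃ c : ℝ, c = 512 ^ 6 * 1024 * 4 ^ 13 * 98304 ^ 12 := ⟨_, rfl⟩
  have hc1 : 1 ≤ c := by rw [hc]; norm_num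
  obtain ⟨K₁, hK₁⟩ : ∃ K₁ : ℝ, K₁ = 1 + 128 * C := ⟨_, rfl⟩
  obtain ⟨K₂, hK₂⟩ : ∃ K₂ : ℝ, K₂ = 2 * c * (1 + C ^ 2) := ⟨_, rfl⟩
  have hK₁1 : 1 ≤ K₁ := by rw [hK₁]; linarith
  have hK₂1 : 1 ≤ K₂ := by
    have : 0 ≤ c * C ^ 2 := by positivity
    rw [hK₂]; linarith
  have hc0 : 0 < c := by linarith
  have hK₁0 : 0 < K₁ := by linarith
  have hK₂0 : 0 < K₂ := by linarith
  refine ⟨K₁ + K₂ + 2 * c + 5, by linarith, fun F _ _ A hA hAC => ?_⟩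
  classical
  have hn1 : (1 : ℝ) ≤ #A := by exact_mod_cast hA.card_pos
  have hn : (0 : ℝ) < #A := by linarith
  have hq : (0 : ℝ) < Fintype.card F := by exact_mod_cast Fintype.card_pos
  have hnq : (#A : ℝ) ≤ Fintype.card F := by exact_mod_cast card_le_univ A
  set n : ℝ := ((#A : ℕ) : ℝ) with hndef
  set q : ℝ := ((Fintype.card F : ℕ) : ℝ) with hqdef
  set x : ℝ := n ^ (-(1 / 104) : ℝ) with hx
  set y : ℝ := (n / q) ^ (1 / 95 : ℝ) with hy
  have hx0 : 0 < x := by positivity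
  have hy0 : 0 < y := by positivity
  have hxy : 0 ≤ x + y := by linarith
  have hx1 : x ≤ 1 := Real.rpow_le_one_of_one_le_of_nonpos hn1 (by norm_num)
  have hy1 : y ≤ 1 := Real.rpow_le_one (by positivity) ((div_le_one hq).2 hnq) (by norm_num)
  have hU : n ^ (5 - 1 / 104 : ℝ) = x * n ^ 5 := by
    rw [hx, ← Real.rpow_natCast, ← Real.rpow_add hn]
    norm_num
  have hV : q ^ (-(1 / 95) : ℝ) * n ^ (5 + 1 / 95 : ℝ) = y * n ^ 5 := by
    rw [hy, Real.div_rpow hn.le hq.le, Real.rpow_add hn, Real.rpow_neg hq.le,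
      ← Real.rpow_natCast n 5]
    push_cast
    field_simp
  have hx104 : x ^ 104 = n⁻¹ := by
    rw [hx, ← Real.rpow_natCast, ← Real.rpow_mul hn.le, ← Real.rpow_neg_one]
    norm_num
  have hx2 : n ^ (51 / 52 : ℝ) = x ^ 2 * n := by
    rw [hx, ← Real.rpow_natCast, ← Real.rpow_mul hn.le]
    nth_rw 3 [← Real.rpow_one n]
    rw [← Real.rpow_add hn]
    norm_num
  have hy95 : y ^ 95 = n / q := by
    rw [hy, ← Real.rpow_natCast, ← Real.rpow_mul (by positivity)]
    norm_num
  rw [hU, hV]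
  set Γ : ℝ := ((#(similarPairs (distinctTriples A) (distinctTriples A)) : ℕ) : ℝ) with hΓ
  have hT : (collinearTriples A A : ℝ) ≤ Γ + 5 * n ^ 4 := by
    rw [hΓ, hndef]
    exact_mod_cast collinearTriples_le A
  have h5 : n ^ 4 ≤ x * n ^ 5 := by
    have h1 : n⁻¹ ≤ x := by
      rw [← hx104]
      exact pow_le_of_le_one hx0.le hx1 (by norm_num)
    calc n ^ 4 = n⁻¹ * n ^ 5 := by field_simp
      _ ≤ _ := by gcongr
  have hτbound : Γ ≤ (K₁ + K₂ + 2 * c) * (x + y) * n ^ 5 := by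
    rcases (show (0 : ℝ) ≤ Γ by positivity).eq_or_lt with h0 | hpos
    · rw [← h0]; positivity
    set τ := Γ / n ^ 5 with hτ
    have hτpos : 0 < τ := by positivity
    have hΓτ : Γ = τ * n ^ 5 := by rw [hτ]; field_simp
    rw [hΓτ]
    refine mul_le_mul_of_nonneg_right ?_ (by positivity)
    rcases similarPairs_bound hC hτpos hA hAC hΓτ with h | h
    · rw [← hndef, hx2] at h
      have h1 : τ ^ 2 ≤ K₁ * x ^ 2 := by
        have h2 : τ ^ 2 ≤ 128 * C * x ^ 2 := by
          refine le_of_mul_le_mul_right ?_ hn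
          linarith
        rw [hK₁]
        nlinarith [sq_nonneg x]
      have h2 := le_mul_of_pow_le_mul_pow two_ne_zero le_rfl hx0.le hx1 hK₁1 h1
      have h3 : 0 ≤ K₁ * y := mul_nonneg hK₁0.le hy0.le
      have h4 : 0 ≤ (K₂ + 2 * c) * (x + y) := mul_nonneg (by linarith) hxy
      linarith
    · rw [← hndef, ← hqdef, ← hc] at h
      -- Depending on the dominant term, $\tau^{93}\ll n/q=y^{95}$ or $\tau^{93}\ll n^{-1}=x^{104}$.
      -- As $x,y\le1$, the larger exponents may be lowered to $93$.
      rcases le_total (1 + C ^ 2) (n ^ 2 / q) with h1 | h1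
      · have h2 : τ ^ 93 ≤ 2 * c * y ^ 95 := by
          rw [hy95]
          refine le_of_mul_le_mul_left ?_ hn
          calc n * τ ^ 93 ≤ c * (1 + C ^ 2 + n ^ 2 / q) := h
            _ ≤ c * (n ^ 2 / q + n ^ 2 / q) := by gcongr
            _ = _ := by ring
        have h3 := le_mul_of_pow_le_mul_pow (by norm_num) (by norm_num) hy0.le hy1
          (by linarith) h2
        have h4 : 0 ≤ 2 * c * x := mul_nonneg (by linarith) hx0.le
        have h6 : 0 ≤ (K₁ + K₂) * (x + y) := mul_nonneg (by linarith) hxy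
        linarith
      · have h2 : τ ^ 93 ≤ K₂ * x ^ 104 := by
          rw [hx104]
          refine le_of_mul_le_mul_left ?_ hn
          calc n * τ ^ 93 ≤ c * (1 + C ^ 2 + n ^ 2 / q) := h
            _ ≤ c * (1 + C ^ 2 + (1 + C ^ 2)) := by gcongr
            _ = _ := by rw [hK₂]; field_simp; ring
        have h3 := le_mul_of_pow_le_mul_pow (by norm_num) (by norm_num) hx0.le hx1 hK₂1 h2
        have h4 : 0 ≤ K₂ * y := mul_nonneg hK₂0.le hy0.le
        have h6 : 0 ≤ (K₁ + 2 * c) * (x + y) := mul_nonneg (by linarith) hxy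
        linarith
  have h6 : 0 ≤ y * n ^ 5 := by positivity
  linarith

end CollinearTriples

/-! ### From collinear triples to incidences and determined lines -/

section Lines

variable {F : Type*} [Field F]

theorem IsPlaneLine.det_eq {l : AffineSubspace F (F × F)} (hl : IsPlaneLine l) {p q r : F × F}
    (hp : p ∈ l) (hq : q ∈ l) (hr : r ∈ l) :
    (q.1 - p.1) * (r.2 - p.2) = (r.1 - p.1) * (q.2 - p.2) := by
  obtain ⟨v, -, hv⟩ := finrank_eq_one_iff'.1 hl
  obtain ⟨c, hc⟩ := hv ⟨_, AffineSubspace.vsub_mem_direction hq hp⟩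
  obtain ⟨d, hd⟩ := hv ⟨_, AffineSubspace.vsub_mem_direction hr hp⟩
  have hc := congrArg Subtype.val hc
  have hd := congrArg Subtype.val hd
  have c1 := congrArg Prod.fst hc
  have c2 := congrArg Prod.snd hc
  have d1 := congrArg Prod.fst hd
  have d2 := congrArg Prod.snd hd
  simp at c1 c2 d1 d2
  rw [← c1, ← c2, ← d1, ← d2]
  ring

theorem IsPlaneLine.eq_of_mem {l l' : AffineSubspace F (F × F)} (hl : IsPlaneLine l)
    (hl' : IsPlaneLine l') {p q : F × F} (hpq : p ≠ q) (hp : p ∈ l) (hq : q ∈ l) (hp' : p ∈ l')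
    (hq' : q ∈ l') : l = l' := by
  have key : ∀ {m : AffineSubspace F (F × F)}, IsPlaneLine m → p ∈ m → q ∈ m →
      Submodule.span F {q -ᵥ p} = m.direction := by
    intro m hm hp hq
    refine Submodule.eq_of_le_of_finrank_eq ?_ ?_
    · rw [Submodule.span_singleton_le_iff_mem]
      exact AffineSubspace.vsub_mem_direction hq hp
    · rw [finrank_span_singleton (vsub_ne_zero.2 hpq.symm)]
      exact hm.symm
  exact AffineSubspace.ext_of_direction_eq ((key hl hp hq).symm.trans (key hl' hp' hq'))
    ⟨p, hp, hp'⟩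

theorem isPlaneLine_affineSpan_pair {p q : F × F} (hpq : p ≠ q) :
    IsPlaneLine (affineSpan F {p, q}) := by
  unfold IsPlaneLine
  rw [direction_affineSpan, vectorSpan_eq_span_vsub_set_left F (Set.mem_insert p {q})]
  rw [Set.image_pair, vsub_self, Submodule.span_insert_zero]
  exact finrank_span_singleton (vsub_ne_zero.2 hpq)

-- Ordered triples $(p,q,r)$ on a line with $p\ne q$ determine that line, so no triple is counted
-- twice. A line with $N\ge2$ points carries $N^2(N-1)\ge N^3/2$ of them.
open Classical in
theorem sum_card_cube_le_collinearTriples (A : Finset F) (L : Finset (AffineSubspace F (F × F)))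
    (hL : ∀ l ∈ L, IsPlaneLine l) (h2 : ∀ l ∈ L, 2 ≤ #{p ∈ A ×ˢ A | p ∈ l}) :
    ∑ l ∈ L, #{p ∈ A ×ˢ A | p ∈ l} ^ 3 ≤ 2 * collinearTriples A A := by
  set N : AffineSubspace F (F × F) → Finset (F × F) := fun l => {p ∈ A ×ˢ A | p ∈ l} with hN
  set Z : Set ((F × F × F) × (F × F × F)) := {t |
    (t.1.1 ∈ A ∧ t.1.2.1 ∈ A ∧ t.1.2.2 ∈ A) ∧
    (t.2.1 ∈ A ∧ t.2.2.1 ∈ A ∧ t.2.2.2 ∈ A) ∧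
    (t.1.2.1 - t.1.1) * (t.2.2.2 - t.2.1) = (t.1.2.2 - t.1.1) * (t.2.2.1 - t.2.1)} with hZ
  have hZfin : Z.Finite := by
    refine ((A ×ˢ A ×ˢ A) ×ˢ (A ×ˢ A ×ˢ A)).finite_toSet.subset fun t ht => ?_
    simp only [mem_coe, mem_product]
    exact ⟨ht.1, ht.2.1⟩
  have h1 : #(L.sigma fun l => (N l).offDiag ×ˢ N l) ≤ collinearTriples A A := by
    rw [collinearTriples, ← Set.ncard_coe_finset]
    refine Set.ncard_le_ncard_of_injOn
      (fun x => ((x.2.1.1.1, x.2.1.2.1, x.2.2.1), (x.2.1.1.2, x.2.1.2.2, x.2.2.2))) ?_ ?_ hZfin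
    · rintro ⟨l, ⟨p, q⟩, r⟩ hx
      simp only [coe_sigma, Set.mem_sigma_iff, mem_coe, mem_product, mem_offDiag, hN,
        mem_filter] at hx
      obtain ⟨hl, ⟨⟨hpA, hp⟩, ⟨hqA, hq⟩, -⟩, hrA, hr⟩ := hx
      exact ⟨⟨hpA.1, hqA.1, hrA.1⟩, ⟨hpA.2, hqA.2, hrA.2⟩, (hL l hl).det_eq hp hq hr⟩
    · rintro ⟨l, ⟨p, q⟩, r⟩ hx ⟨l', ⟨p', q'⟩, r'⟩ hx' heq
      simp only [coe_sigma, Set.mem_sigma_iff, mem_coe, mem_product, mem_offDiag, hN,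
        mem_filter] at hx hx'
      simp only [Prod.mk.injEq] at heq
      obtain ⟨⟨a1, a2, a3⟩, b1, b2, b3⟩ := heq
      obtain rfl : p = p' := Prod.ext a1 b1
      obtain rfl : q = q' := Prod.ext a2 b2
      obtain rfl : r = r' := Prod.ext a3 b3
      obtain ⟨hl, ⟨⟨-, hp⟩, ⟨-, hq⟩, hpq⟩, -⟩ := hx
      obtain ⟨hl', ⟨⟨-, hp'⟩, ⟨-, hq'⟩, -⟩, -⟩ := hx'
      obtain rfl := (hL l hl).eq_of_mem (hL l' hl') hpq hp hq hp' hq'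
      rfl
  rw [card_sigma] at h1
  refine le_trans ?_ (Nat.mul_le_mul_left 2 h1)
  rw [mul_sum]
  refine Finset.sum_le_sum fun l hl => ?_
  rw [card_product, offDiag_card]
  have h3 : 2 ≤ #(N l) := h2 l hl
  obtain ⟨k, hk⟩ := Nat.exists_eq_add_of_le h3
  have h4 : #(N l) * #(N l) - #(N l) = #(N l) * (1 + k) := by
    rw [hk, ← Nat.mul_sub_one]
    congr 1
    omega
  change #(N l) ^ 3 ≤ _
  rw [h4, hk]
  nlinarith [Nat.zero_le k, Nat.zero_le (k ^ 2), Nat.zero_le (k ^ 3)]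

open Classical in
theorem incidences_eq_sum (P : Finset (F × F)) (L : Finset (AffineSubspace F (F × F))) :
    incidences P L = ∑ l ∈ L, #{p ∈ P | p ∈ l} := by
  have h : {x : (F × F) × AffineSubspace F (F × F) | x.1 ∈ P ∧ x.2 ∈ L ∧ x.1 ∈ x.2} =
      ({x ∈ P ×ˢ L | x.1 ∈ x.2} : Finset _) := by
    ext x
    simp [and_assoc]
  rw [incidences, h, Set.ncard_coe_finset]
  simp only [card_filter, sum_product_right]

/-- Lines with at most one point contribute at most $|L|$; Hölder with the third moment handles the
others, whose contribution is $s$. -/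
theorem exists_incidences_le (A : Finset F) (L : Finset (AffineSubspace F (F × F)))
    (hL : ∀ l ∈ L, IsPlaneLine l) :
    ∃ s : ℝ, 0 ≤ s ∧ (incidences (A ×ˢ A) L : ℝ) ≤ s + #L ∧
      s ^ 3 ≤ (#L : ℝ) ^ 2 * (2 * collinearTriples A A) := by
  classical
  set L' := {l ∈ L | 2 ≤ #{p ∈ A ×ˢ A | p ∈ l}} with hL'
  refine ⟨∑ l ∈ L', (#{p ∈ A ×ˢ A | p ∈ l} : ℝ),
    sum_nonneg fun _ _ => Nat.cast_nonneg _, ?_, ?_⟩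
  · rw [incidences_eq_sum, ← sum_filter_add_sum_filter_not L (fun l => 2 ≤ #{p ∈ A ×ˢ A | p ∈ l})]
    push_cast
    refine add_le_add le_rfl ?_
    calc _ ≤ ∑ l ∈ L with ¬ 2 ≤ #{p ∈ A ×ˢ A | p ∈ l}, (1 : ℝ) := by
          refine Finset.sum_le_sum fun l hl => ?_
          have := (mem_filter.1 hl).2
          exact_mod_cast (by omega : #{p ∈ A ×ˢ A | p ∈ l} ≤ 1)
      _ ≤ #L := by
          rw [sum_const, nsmul_eq_mul, mul_one]
          exact_mod_cast card_filter_le _ _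
  · have h1 := pow_sum_le_card_mul_sum_pow (s := L')
      (f := fun l => (#{p ∈ A ×ˢ A | p ∈ l} : ℝ)) (fun _ _ => Nat.cast_nonneg _) 2

    have h2 : ∑ l ∈ L', (#{p ∈ A ×ˢ A | p ∈ l} : ℝ) ^ 3 ≤ 2 * collinearTriples A A := by
      exact_mod_cast sum_card_cube_le_collinearTriples A L'
        (fun l hl => hL l (mem_filter.1 hl).1) fun l hl => (mem_filter.1 hl).2
    have h3 : (#L' : ℝ) ≤ #L := by exact_mod_cast card_filter_le _ _
    have h4 : (0 : ℝ) ≤ ∑ l ∈ L', (#{p ∈ A ×ˢ A | p ∈ l} : ℝ) ^ 3 :=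
      sum_nonneg fun _ _ => pow_nonneg (Nat.cast_nonneg _) 3
    calc _ ≤ (#L' : ℝ) ^ 2 * ∑ l ∈ L', (#{p ∈ A ×ˢ A | p ∈ l} : ℝ) ^ 3 := h1
      _ ≤ _ := mul_le_mul (pow_le_pow_left₀ (Nat.cast_nonneg _) h3 2) h2 h4
          (pow_nonneg (Nat.cast_nonneg _) 2)

/-- Hölder, obtained from two uses of Cauchy–Schwarz: the second moment against the first and third,
and the first against the second. -/
theorem sum_sq_pow_three_le {ι : Type*} (s : Finset ι) (f : ι → ℝ) (hf : ∀ i ∈ s, 0 ≤ f i) :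
    (∑ i ∈ s, f i ^ 2) ^ 3 ≤ #s * (∑ i ∈ s, f i ^ 3) ^ 2 := by
  have h0 : 0 ≤ ∑ i ∈ s, f i ^ 2 := sum_nonneg fun i _ => sq_nonneg _
  rcases h0.eq_or_lt with h | hpos
  · rw [← h]; simp; positivity
  have h1 : (∑ i ∈ s, f i) ^ 2 ≤ #s * ∑ i ∈ s, f i ^ 2 := sq_sum_le_card_mul_sum_sq
  have h2 : (∑ i ∈ s, f i ^ 2) ^ 2 ≤ (∑ i ∈ s, f i) * ∑ i ∈ s, f i ^ 3 :=
    sum_sq_le_sum_mul_sum_of_sq_le_mul s hf (fun i hi => pow_nonneg (hf i hi) 3)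
      fun i _ => le_of_eq (by ring)
  refine le_of_mul_le_mul_right ?_ hpos
  calc (∑ i ∈ s, f i ^ 2) ^ 3 * ∑ i ∈ s, f i ^ 2 = ((∑ i ∈ s, f i ^ 2) ^ 2) ^ 2 := by ring
    _ ≤ ((∑ i ∈ s, f i) * ∑ i ∈ s, f i ^ 3) ^ 2 := by gcongr
    _ = (∑ i ∈ s, f i) ^ 2 * (∑ i ∈ s, f i ^ 3) ^ 2 := by ring
    _ ≤ (#s * ∑ i ∈ s, f i ^ 2) * (∑ i ∈ s, f i ^ 3) ^ 2 := by gcongr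
    _ = _ := by ring

/-- The at least $|A|^4/2$ ordered pairs of distinct points are covered by the determined lines, so
the second moment of points per line is large. The third moment is at most $2T(A)$, which forces
many lines. -/
theorem pow_le_determinedLines (A : Finset F) (hA : 1 < #A) :
    (#A : ℝ) ^ 12 ≤ 32 * (collinearTriples A A : ℝ) ^ 2 * determinedLines (A ×ˢ A) := by
  classical
  set P := A ×ˢ A with hP
  set L : Finset (AffineSubspace F (F × F)) :=
    P.offDiag.image fun x => affineSpan F {x.1, x.2} with hL
  have hdet : determinedLines P = #L := by
    rw [determinedLines, ← Set.ncard_coe_finset]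
    congr 1
    ext l
    constructor
    · rintro ⟨p, hp, r, hr, hpr, rfl⟩
      exact mem_image.2 ⟨(p, r), mem_offDiag.2 ⟨hp, hr, hpr⟩, rfl⟩
    · intro hl
      obtain ⟨⟨p, r⟩, hpr, rfl⟩ := mem_image.1 hl
      obtain ⟨hp, hr, hne⟩ := mem_offDiag.1 hpr
      exact ⟨p, hp, r, hr, hne, rfl⟩
  have hline : ∀ l ∈ L, IsPlaneLine l := by
    intro l hl
    obtain ⟨⟨p, r⟩, hpr, rfl⟩ := mem_image.1 hl
    exact isPlaneLine_affineSpan_pair (mem_offDiag.1 hpr).2.2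
  have htwo : ∀ l ∈ L, 2 ≤ #{p ∈ P | p ∈ l} := by
    intro l hl
    obtain ⟨⟨p, r⟩, hpr, rfl⟩ := mem_image.1 hl
    obtain ⟨hp, hr, hne⟩ := mem_offDiag.1 hpr
    exact one_lt_card.2 ⟨p, mem_filter.2 ⟨hp, left_mem_affineSpan_pair F p r⟩, r,
      mem_filter.2 ⟨hr, right_mem_affineSpan_pair F p r⟩, hne⟩
  have hpairs : #P.offDiag ≤ ∑ l ∈ L, #{p ∈ P | p ∈ l} ^ 2 := by
    calc #P.offDiag = ∑ l ∈ L, #{x ∈ P.offDiag | affineSpan F {x.1, x.2} = l} :=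
          card_eq_sum_card_image _ _
      _ ≤ _ := by
          refine Finset.sum_le_sum fun l _ => ?_
          rw [sq, ← card_product]
          refine card_le_card fun x hx => ?_
          obtain ⟨hx', rfl⟩ := mem_filter.1 hx
          obtain ⟨hp, hr, -⟩ := mem_offDiag.1 hx'
          exact mem_product.2 ⟨mem_filter.2 ⟨hp, left_mem_affineSpan_pair F _ _⟩,
            mem_filter.2 ⟨hr, right_mem_affineSpan_pair F _ _⟩⟩
  have hcube := sum_card_cube_le_collinearTriples A L hline htwo
  have hn2 : (2 : ℝ) ≤ #A := by exact_mod_cast hA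
  have hoff : (#A : ℝ) ^ 4 / 2 ≤ #P.offDiag := by
    have h1 : #P.offDiag + #A ^ 2 = #A ^ 4 := by
      have h2 : #P = #A ^ 2 := by rw [hP, card_product, sq]
      rw [offDiag_card, h2, Nat.sub_add_cancel (Nat.le_mul_self _)]
      ring
    have h2 : (#P.offDiag : ℝ) + (#A : ℝ) ^ 2 = (#A : ℝ) ^ 4 := by exact_mod_cast h1
    have h3 : (0 : ℝ) ≤ (#A : ℝ) ^ 2 * ((#A : ℝ) ^ 2 - 2) :=
      mul_nonneg (by positivity) (by nlinarith)
    linarith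
  have h3 := sum_sq_pow_three_le L (fun l => (#{p ∈ P | p ∈ l} : ℝ)) fun l _ => Nat.cast_nonneg _
  have h4 : (#P.offDiag : ℝ) ≤ ∑ l ∈ L, (#{p ∈ P | p ∈ l} : ℝ) ^ 2 := by exact_mod_cast hpairs
  have h5 : ∑ l ∈ L, (#{p ∈ P | p ∈ l} : ℝ) ^ 3 ≤ 2 * collinearTriples A A := by
    exact_mod_cast hcube
  have h6 : (0 : ℝ) ≤ ∑ l ∈ L, (#{p ∈ P | p ∈ l} : ℝ) ^ 3 := sum_nonneg fun _ _ => pow_nonneg (Nat.cast_nonneg _) 3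
  rw [hdet]
  generalize ∑ l ∈ L, (#{p ∈ P | p ∈ l} : ℝ) ^ 2 = s₂ at h3 h4
  generalize ∑ l ∈ L, (#{p ∈ P | p ∈ l} : ℝ) ^ 3 = s₃ at h3 h5 h6
  calc (#A : ℝ) ^ 12 = 8 * ((#A : ℝ) ^ 4 / 2) ^ 3 := by ring
    _ ≤ 8 * s₂ ^ 3 := by gcongr; exact hoff.trans h4
    _ ≤ 8 * (#L * s₃ ^ 2) := by gcongr
    _ ≤ 8 * (#L * (2 * collinearTriples A A) ^ 2) := by gcongr
    _ = _ := by ring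

end Lines

end

/-! ### Deduction of the three estimates -/

theorem theorem2 (C : ℝ) (hC : 0 < C) :
    ∃ K : ℝ, 0 < K ∧
      ∀ (F : Type*) [Field F] [Fintype F] (q : ℕ), q = Fintype.card F →
      ∀ A : Finset F, 1 < A.card → AvoidsSubfields C A →
        ((collinearTriples A A : ℝ) ≤
          K * ((A.card : ℝ) ^ (5 - 1 / 104 : ℝ)
            + (q : ℝ) ^ (-(1 / 95) : ℝ) * (A.card : ℝ) ^ (5 + 1 / 95 : ℝ))) ∧
        (∀ L : Finset (AffineSubspace F (F × F)), (∀ l ∈ L, IsPlaneLine l) →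
          (incidences (A ×ˢ A) L : ℝ) ≤
            K * (((A.card : ℝ) ^ (173 / 104 : ℝ)
              + (q : ℝ) ^ (-(1 / 285) : ℝ) * (A.card : ℝ) ^ (476 / 285 : ℝ))
                * (L.card : ℝ) ^ (2 / 3 : ℝ) + (L.card : ℝ))) ∧
        (min ((A.card : ℝ) ^ (2 + 1 / 52 : ℝ))
            ((q : ℝ) ^ (2 / 95 : ℝ) * (A.card : ℝ) ^ (2 - 2 / 95 : ℝ)) ≤
          K * (determinedLines (A ×ˢ A) : ℝ)) := by
  obtain ⟨K₀, hK₀, hT⟩ := collinearTriples_bound C hC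
  have hK₀sq : K₀ ≤ K₀ ^ 2 := by nlinarith
  refine ⟨128 * K₀ ^ 2, by positivity, ?_⟩
  rintro F _ _ q rfl A hA hAC
  have hAne : A.Nonempty := Finset.card_pos.1 (by omega)
  have hn : (0 : ℝ) < A.card := by exact_mod_cast hAne.card_pos
  have hq : (0 : ℝ) < Fintype.card F := by exact_mod_cast Fintype.card_pos
  have hT := hT F A hAne hAC
  have hpow := pow_le_determinedLines A hA
  have hinc := exists_incidences_le A
  generalize (A.card : ℝ) = n at *
  generalize (Fintype.card F : ℝ) = q at *
  generalize hTT : (collinearTriples A A : ℝ) = T at *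
  have hT0 : 0 ≤ T := hTT ▸ Nat.cast_nonneg _
  set U := n ^ (5 - 1 / 104 : ℝ) with hU
  set V := q ^ (-(1 / 95) : ℝ) * n ^ (5 + 1 / 95 : ℝ) with hV
  have hU0 : 0 < U := by positivity
  have hV0 : 0 < V := by positivity
  refine ⟨?_, ?_, ?_⟩
  · have : K₀ * (U + V) ≤ 128 * K₀ ^ 2 * (U + V) :=
      mul_le_mul_of_nonneg_right (by linarith) (by positivity)
    linarith
  · intro L hL
    obtain ⟨s, hs0, hs1, hs2⟩ := hinc L hL
    set u := n ^ (173 / 104 : ℝ) with hu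
    set v := q ^ (-(1 / 285) : ℝ) * n ^ (476 / 285 : ℝ) with hv
    set z := (L.card : ℝ) ^ (2 / 3 : ℝ) with hz
    have hu0 : 0 < u := by positivity
    have hv0 : 0 < v := by positivity
    have hz0 : 0 ≤ z := by positivity
    have hu3 : u ^ 3 = U := by
      rw [hu, hU, ← Real.rpow_natCast, ← Real.rpow_mul hn.le]
      norm_num
    have hv3 : v ^ 3 = V := by
      rw [hv, hV, mul_pow, ← Real.rpow_natCast, ← Real.rpow_mul hq.le, ← Real.rpow_natCast,
        ← Real.rpow_mul hn.le]
      norm_num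
    have hz3 : z ^ 3 = (L.card : ℝ) ^ 2 := by
      rw [hz, ← Real.rpow_natCast, ← Real.rpow_mul (Nat.cast_nonneg _), ← Real.rpow_natCast]
      norm_num
    have huv : U + V ≤ (u + v) ^ 3 := by
      rw [← hu3, ← hv3]
      have : 0 ≤ 3 * u ^ 2 * v + 3 * u * v ^ 2 := by positivity
      linarith
    have hs : s ≤ 2 * K₀ * ((u + v) * z) := by
      refine le_of_pow_le_pow_left₀ (n := 3) (by norm_num) (by positivity) ?_
      have hK3 : 2 * K₀ ≤ (2 * K₀) ^ 3 := le_self_pow₀ (by linarith) (by norm_num)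
      calc s ^ 3 ≤ (L.card : ℝ) ^ 2 * (2 * T) := hs2
        _ ≤ z ^ 3 * (2 * (K₀ * (u + v) ^ 3)) := by
            rw [hz3]
            gcongr
            exact hT.trans (by gcongr)
        _ = 2 * K₀ * ((u + v) * z) ^ 3 := by ring
        _ ≤ (2 * K₀) ^ 3 * ((u + v) * z) ^ 3 := by gcongr
        _ = _ := by ring
    have h1 : 2 * K₀ * ((u + v) * z) ≤ 128 * K₀ ^ 2 * ((u + v) * z) :=
      mul_le_mul_of_nonneg_right (by linarith) (by positivity)
    have h2 : (1 : ℝ) * L.card ≤ 128 * K₀ ^ 2 * L.card :=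
      mul_le_mul_of_nonneg_right (by linarith) (Nat.cast_nonneg _)
    linarith
  · generalize hD : (determinedLines (A ×ˢ A) : ℝ) = D at *
    have hD0 : 0 ≤ D := hD ▸ Nat.cast_nonneg _
    have hU2 : n ^ (2 + 1 / 52 : ℝ) * U ^ 2 = n ^ 12 := by
      rw [hU, ← Real.rpow_natCast, ← Real.rpow_mul hn.le, ← Real.rpow_add hn, ← Real.rpow_natCast]
      norm_num
    have hV2 : q ^ (2 / 95 : ℝ) * n ^ (2 - 2 / 95 : ℝ) * V ^ 2 = n ^ 12 := by
      have h1 : q ^ (2 / 95 : ℝ) * (q ^ (-(1 / 95) : ℝ)) ^ 2 = 1 := by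
        rw [← Real.rpow_natCast, ← Real.rpow_mul hq.le, ← Real.rpow_add hq]
        norm_num
      have h2 : n ^ (2 - 2 / 95 : ℝ) * (n ^ (5 + 1 / 95 : ℝ)) ^ 2 = n ^ 12 := by
        rw [← Real.rpow_natCast, ← Real.rpow_mul hn.le, ← Real.rpow_add hn, ← Real.rpow_natCast]
        norm_num
      rw [hV, ← h2]
      linear_combination (n ^ (2 - 2 / 95 : ℝ) * (n ^ (5 + 1 / 95 : ℝ)) ^ 2) * h1
    -- With $W$ the larger of $U$ and $V$, $T\le 2K_0W$; the constant is $128=32\cdot2^2$.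
    have key : ∀ {m W : ℝ}, 0 < W → U ≤ W → V ≤ W → m * W ^ 2 = n ^ 12 →
        m ≤ 128 * K₀ ^ 2 * D := by
      intro m W hW hUW hVW hm
      have hW2 : 0 < W ^ 2 := by positivity
      refine le_of_mul_le_mul_right ?_ hW2
      have hTW : T ≤ K₀ * (2 * W) := hT.trans (by gcongr; linarith)
      calc m * W ^ 2 = n ^ 12 := hm
        _ ≤ 32 * T ^ 2 * D := hpow
        _ ≤ 32 * (K₀ * (2 * W)) ^ 2 * D := by gcongr
        _ = _ := by ring
    rcases le_total V U with h | h
    · exact (min_le_left _ _).trans (key hU0 le_rfl h hU2)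
    · exact (min_le_right _ _).trans (key hV0 h le_rfl hV2)
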